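/- Let $S^2\subset\mathbb R^3$ be the unit sphere with round metric $\sigma_{AB}$, Levi-Civita connection $\nabla$, Laplacian $\Delta$ and area form $\epsilon_{AB}$. Let $\tilde X^1,\tilde X^2,\tilde X^3$ be the restrictions to $S^2$ of the coordinates of $\mathbb R^3$, and put $Y^A=\epsilon^{AB}\nabla_B\tilde X^k$. All integrals are with respect to the area measure of $S^2$, and indices are raised and lowered with $\sigma$. **Null infinity data.** Let $I\subset\mathbb R$ be an interval. Null infinity data of a vacuum spacetime on $I\times S^2$ in a Bondi–Sachs coordinate system $(u,x)$ consist of a mass aspect $m(u,x)$, an angular momentum aspect $N_A(u,x)$ (a one-form on $S^2$) and a shear $C_{AB}(u,x)$ (a symmetric traceless 2-tensor on $S^2$), all smooth in $(u,x)$, which satisfy, with the news $N_{AB}=\partial_uC_{AB}$, the evolution equations induced by the vacuum Einstein equation: $$\partial_u m=-\tfrac18N_{AB}N^{AB}+\tfrac14\nabla^A\nabla^BN_{AB},$$ $$\partial_uN_A=\nabla_Am-\tfrac14\nabla^BP_{BA}+\tfrac14\nabla_A(C_{BE}N^{BE})-\tfrac14\nabla_B(C^{BD}N_{DA})+\tfrac12C_{AB}\nabla_DN^{DB},$$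 where $P_{BA}=\nabla_B\nabla^EC_{EA}-\nabla_A\nabla^EC_{EB}$. **Potentials.** Smooth functions $c,\underline c$ on $S^2$ are the potentials of a symmetric traceless tensor $C_{AB}$ if both are $L^2$-orthogonal to $1,\tilde X^1,\tilde X^2,\tilde X^3$ and $$C_{AB}=\nabla_A\nabla_Bc-\tfrac12\sigma_{AB}\Delta c+\underline F_{AB},\qquad \underline F_{AB}=\tfrac12\left(\epsilon_A{}^E\nabla_E\nabla_B\underline c+\epsilon_B{}^E\nabla_E\nabla_A\underline c\right).$$ **Chen–Wang–Yau (CWY) angular momentum and center of mass.** For $k=1,2,3$, with $c,\underline c$ the potentials of $C_{AB}(u,\cdot)$, $$J^k(u)=\int_{S^2}\epsilon^{AB}\nabla_B\tilde X^k\left(N_A-\tfrac14C_{AB}\nabla_DC^{DB}-c\nabla_Am\right),$$ $$C^k(u)=\int_{S^2}\nabla^A\tilde X^k\Big[N_A-u\nabla_Am-\tfrac14C_{AB}\nabla_DC^{DB}-\tfrac1{16}\nabla_A(C^{DE}C_{DE})-c\nabla_Am+2\epsilon_{AB}(\nabla^B\underline c)m\Big]+\int_{S^2}\Big(3\tilde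 X^kcm-\tfrac14\tilde X^k\nabla_A\underline F^{AB}\nabla^D\underline F_{DB}\Big).$$ **Supertranslation.** For $f\in C^\infty(S^2)$, the supertranslation $u=\bar u+f(x)$ produces the fields in the coordinates $(\bar u,x)$ given by $$\bar m=m+\tfrac12\nabla^BN_{BD}\nabla^Df+\tfrac14\partial_uN_{BD}\nabla^Bf\nabla^Df+\tfrac14N_{BD}\nabla^B\nabla^Df,$$ $$\bar C_{AB}=C_{AB}-2\nabla_A\nabla_Bf+\Delta f\,\sigma_{AB},$$ and, when the news vanishes, $$\bar N_A=N_A+3m\nabla_Af-\tfrac34P_{BA}\nabla^Bf.$$ Here the left sides are evaluated at $(\bar u,x)$ and the fields and their derivatives on the right sides at $(\bar u+f(x),x)$. Let $\bar J^k(\bar u)$ and $\bar C^k(\bar u)$ be defined by the formulas above from the barred fields, the potentials of $\bar C_{AB}(\bar u,\cdot)$, and $\bar u$ in place of $u$. Write $$f_{\ell\le1}=\frac1{4\pi}\int_{S^2}f+\sum_{i=1}^3\Big(\frac3{4\pi}\int_{S^2}f\tilde X^i\Big)\tilde X^i.$$ **Theorem.** Let null infinity data on $I\times S^2$ with $N_{AB}\equiv0$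 be given, and suppose that $c(u,\cdot),\underline c(u,\cdot)$ are the potentials of $C_{AB}(u,\cdot)$ for each $u\in I$. Then: 1. $J^k(u)$ and $C^k(u)$, $k=1,2,3$, are independent of $u\in I$. 2. Let $f\in C^\infty(S^2)$ and let $\bar u_0\in\mathbb R$ satisfy $\bar u_0+f(x)\in I$ for all $x\in S^2$. Let $\bar c,\bar{\underline c}$ be the potentials of $\bar C_{AB}(\bar u_0,\cdot)$. Then for all $u_0\in I$ and $k=1,2,3$, with $\mathring m=m(u_0,\cdot)$, $$\bar J^k(\bar u_0)-J^k(u_0)=-2\int_{S^2}Y^Af_{\ell\le1}\nabla_A\mathring m,$$ $$\bar C^k(\bar u_0)-C^k(u_0)=\int_{S^2}\left(6f_{\ell\le1}\tilde X^k\mathring m-2f_{\ell\le1}\nabla^A\tilde X^k\nabla_A\mathring m\right).$$ -/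

import Mathlib

open MeasureTheory
open scoped Manifold ContDiff

noncomputable section

namespace NullInfinity

/-! ### Tensor calculus on the round unit sphere

Tensors on `S²` are written in Cartesian components of `ℝ³`: a one-form is a field
`w : S² → Fin 3 → ℝ` with `∑ a, x a * w x a = 0`, and similarly for 2-tensors.  In this description
the contraction with the round metric is the sum over repeated Cartesian indices, and the
Levi-Civita connection is the tangential projection of the ambient derivative. -/

/-- The standard unit 2-sphere in `ℝ³`. -/
abbrev S2 : Type := Metric.sphere (0 : EuclideanSpace ℝ (Fin 3)) 1

/-- The area measure of the round unit sphere (total mass `4π`). -/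
def area : Measure S2 := (volume : Measure (EuclideanSpace ℝ (Fin 3))).toSphere

/-- The restriction of the `k`-th Cartesian coordinate of `ℝ³` to the sphere. -/
def coord (k : Fin 3) (x : S2) : ℝ := (x : EuclideanSpace ℝ (Fin 3)) k

/-- Smooth functions on the sphere (Mathlib's manifold structure). -/
def SmoothFn (f : S2 → ℝ) : Prop := ContMDiff (𝓡 2) 𝓘(ℝ, ℝ) ∞ f

theorem normalize_mem {y : EuclideanSpace ℝ (Fin 3)} (hy : y ≠ 0) :
    ‖y‖⁻¹ • y ∈ Metric.sphere (0 : EuclideanSpace ℝ (Fin 3)) 1 := by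
  simp [norm_smul, hy]

open Classical in
/-- The extension `y ↦ f (y / |y|)` of a function on the sphere, constant along rays. -/
def radialExt (f : S2 → ℝ) (y : EuclideanSpace ℝ (Fin 3)) : ℝ :=
  if hy : y ≠ 0 then f ⟨‖y‖⁻¹ • y, normalize_mem hy⟩ else 0

/-- `∇_a f`: the Cartesian components of the differential of `f`. Since the radial extension is
constant along rays, its ambient gradient at a point of the sphere is tangential. -/
def grad (f : S2 → ℝ) (x : S2) (a : Fin 3) : ℝ :=
  fderiv ℝ (radialExt f) (x : EuclideanSpace ℝ (Fin 3)) (EuclideanSpace.single a 1)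

/-- The round metric `σ_{ab}`, equivalently the tangential projection `δ_{ab} - x_a x_b`. -/
def metric (x : S2) (a b : Fin 3) : ℝ := (if a = b then 1 else 0) - coord a x * coord b x

/-- The area form `ε_{ab}`, with `ε(v, w) = det (x, v, w)`. -/
def eps (x : S2) (a b : Fin 3) : ℝ :=
  (!![0, coord 2 x, -coord 1 x; -coord 2 x, 0, coord 0 x; coord 1 x, -coord 0 x, 0] :
    Matrix (Fin 3) (Fin 3) ℝ) a b

/-- `∇_a w_b` for a one-form `w`. -/
def covDeriv₁ (w : S2 → Fin 3 → ℝ) (x : S2) (a b : Fin 3) : ℝ :=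
  ∑ d, metric x b d * grad (fun y => w y d) x a

/-- `∇_a T_{bc}` for a 2-tensor `T`. -/
def covDeriv₂ (T : S2 → Fin 3 → Fin 3 → ℝ) (x : S2) (a b c : Fin 3) : ℝ :=
  ∑ d, ∑ e, metric x b d * metric x c e * grad (fun y => T y d e) x a

/-- `∇^A w_A`. -/
def div₁ (w : S2 → Fin 3 → ℝ) (x : S2) : ℝ := ∑ a, covDeriv₁ w x a a

/-- `∇^A T_{AB}`. -/
def div₂ (T : S2 → Fin 3 → Fin 3 → ℝ) (x : S2) (b : Fin 3) : ℝ := ∑ a, covDeriv₂ T x a a b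

/-- `∇_A ∇_B f`. -/
def hess (f : S2 → ℝ) : S2 → Fin 3 → Fin 3 → ℝ := covDeriv₁ (grad f)

/-- The Laplacian `Δ f = ∇^A ∇_A f`. -/
def lap (f : S2 → ℝ) : S2 → ℝ := div₁ (grad f)

/-- The pointwise inner product `S_{AB} T^{AB}`. -/
def inner₂ (S T : S2 → Fin 3 → Fin 3 → ℝ) (x : S2) : ℝ := ∑ a, ∑ b, S x a b * T x a b

/-- The rotation field `Y^A = ε^{AB} ∇_B X^k`. -/
def rot (k : Fin 3) (x : S2) (a : Fin 3) : ℝ := ∑ b, eps x a b * grad (coord k) x b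

/-- The function has no `ℓ = 0` and no `ℓ = 1` part: it is `L²`-orthogonal to `1, X¹, X², X³`. -/
def SupportedInHighModes (c : S2 → ℝ) : Prop :=
  (∫ x, c x ∂area) = 0 ∧ ∀ i, (∫ x, c x * coord i x ∂area) = 0

/-- `f_{ℓ ≤ 1}`: the `L²`-projection `α₀ + α_i X^i` of `f` to the modes `ℓ = 0, 1`
(recall `∫ 1 = 4π` and `∫ X^i X^j = (4π/3) δ^{ij}`). -/
def lowModes (f : S2 → ℝ) (x : S2) : ℝ :=
  (4 * Real.pi)⁻¹ * (∫ y, f y ∂area) +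
    ∑ i, (3 / (4 * Real.pi) * ∫ y, f y * coord i y ∂area) * coord i x

/-! ### Shear potentials -/

/-- The co-closed tensor
`F̲_{AB} = ½ (ε_A{}^E ∇_E ∇_B c̲ + ε_B{}^E ∇_E ∇_A c̲)` with potential `c̲`. -/
def coclosedPart (cb : S2 → ℝ) (x : S2) (a b : Fin 3) : ℝ :=
  (1 / 2) * ∑ e, (eps x a e * hess cb x e b + eps x b e * hess cb x e a)

/-- `c, c̲` are the potentials (supported in the modes `ℓ ≥ 2`) of the symmetric traceless
tensor `C`. -/
structure IsPotentials (C : S2 → Fin 3 → Fin 3 → ℝ) (c cb : S2 → ℝ) : Prop where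
  smooth_c : SmoothFn c
  smooth_cb : SmoothFn cb
  high_c : SupportedInHighModes c
  high_cb : SupportedInHighModes cb
  decomposition : ∀ x a b,
    C x a b = hess c x a b - (1 / 2) * metric x a b * lap c x + coclosedPart cb x a b

/-! ### Null infinity data -/

/-- The fields on null infinity in a Bondi-Sachs coordinate system `(u, x)`: the mass aspect
`m(u, x)`, the angular momentum aspect `N_A(u, x)` and the shear `C_{AB}(u, x)`. -/
structure Fields where
  m : ℝ → S2 → ℝ
  N : ℝ → S2 → Fin 3 → ℝ
  C : ℝ → S2 → Fin 3 → Fin 3 → ℝ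

/-- The news tensor `N_{AB} = ∂_u C_{AB}` on the interval `I` of retarded times. -/
def Fields.news (D : Fields) (I : Set ℝ) (u : ℝ) (x : S2) (a b : Fin 3) : ℝ :=
  derivWithin (fun s => D.C s x a b) I u

/-- The curl of the divergence of the shear,
`P_{BA} = ∇_B ∇^E C_{EA} - ∇_A ∇^E C_{EB}`. -/
def curlDiv (C : S2 → Fin 3 → Fin 3 → ℝ) (x : S2) (b a : Fin 3) : ℝ :=
  covDeriv₁ (div₂ C) x b a - covDeriv₁ (div₂ C) x a b

/-- A real function on `I × S²` which is smooth in `(u, x)`. -/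
def SmoothOn (I : Set ℝ) (F : ℝ → S2 → ℝ) : Prop :=
  ContMDiffOn (𝓘(ℝ, ℝ).prod (𝓡 2)) 𝓘(ℝ, ℝ) ∞ (fun p : ℝ × S2 => F p.1 p.2) (I ×ˢ Set.univ)

/-- Null infinity data on `I × S²` of an asymptotically flat vacuum spacetime: smooth fields
`m, N_A, C_{AB}`, with `N_A` a one-form and `C_{AB}` a symmetric traceless 2-tensor on the sphere,
obeying the evolution equations that the vacuum Einstein equation induces on null infinity. -/
structure Fields.IsNullInfinityData (D : Fields) (I : Set ℝ) : Prop where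
  smooth_m : SmoothOn I D.m
  smooth_N : ∀ a, SmoothOn I (fun u x => D.N u x a)
  smooth_C : ∀ a b, SmoothOn I (fun u x => D.C u x a b)
  tangent_N : ∀ u ∈ I, ∀ x, ∑ a, coord a x * D.N u x a = 0
  tangent_C : ∀ u ∈ I, ∀ x b, ∑ a, coord a x * D.C u x a b = 0
  symm_C : ∀ u ∈ I, ∀ x a b, D.C u x a b = D.C u x b a
  traceless_C : ∀ u ∈ I, ∀ x, ∑ a, D.C u x a a = 0
  /-- `∂_u m = -⅛ N_{AB} N^{AB} + ¼ ∇^A ∇^B N_{AB}` -/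
  evolution_m : ∀ u ∈ I, ∀ x,
    derivWithin (fun s => D.m s x) I u =
      -(1 / 8) * inner₂ (D.news I u) (D.news I u) x + (1 / 4) * div₁ (div₂ (D.news I u)) x
  /-- `∂_u N_A = ∇_A m - ¼ ∇^B (∇_B ∇^E C_{EA} - ∇_A ∇^E C_{EB}) + ¼ ∇_A (C_{BE} N^{BE})
  - ¼ ∇_B (C^{BD} N_{DA}) + ½ C_{AB} ∇_D N^{DB}` -/
  evolution_N : ∀ u ∈ I, ∀ x a,
    derivWithin (fun s => D.N s x a) I u =
      grad (D.m u) x a - (1 / 4) * div₂ (curlDiv (D.C u)) x a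
        + (1 / 4) * grad (inner₂ (D.C u) (D.news I u)) x a
        - (1 / 4) * div₂ (fun y b e => ∑ d, D.C u y b d * D.news I u y d e) x a
        + (1 / 2) * ∑ b, D.C u x a b * div₂ (D.news I u) x b

/-- The news vanishes identically on `I × S²`. -/
def Fields.VanishingNews (D : Fields) (I : Set ℝ) : Prop :=
  ∀ u ∈ I, ∀ x a b, D.news I u x a b = 0

/-- The fields in the Bondi-Sachs coordinate system `(ū, x)` related to `(u, x)` by the
supertranslation `u = ū + f(x)`:
* `m̄(ū, x) = m + ½ ∇^B N_{BD} ∇^D f + ¼ ∂_u N_{BD} ∇^B f ∇^D f + ¼ N_{BD} ∇^B ∇^D f`,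
* `N̄_A(ū, x) = N_A + 3 m ∇_A f - ¾ P_{BA} ∇^B f`, which is the transformation law of the angular
  momentum aspect for vanishing news (the only case in which it is used),
* `C̄_{AB}(ū, x) = C_{AB} - 2 ∇_A ∇_B f + Δf σ_{AB}`,

where the (derivatives of the) original fields on the right are evaluated at `(ū + f(x), x)`. -/
def Fields.supertranslate (D : Fields) (I : Set ℝ) (f : S2 → ℝ) : Fields where
  m := fun ub x =>
    D.m (ub + f x) x
      + (1 / 2) * ∑ d, div₂ (D.news I (ub + f x)) x d * grad f x d
      + (1 / 4) * ∑ b, ∑ d,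
          derivWithin (fun s => D.news I s x b d) I (ub + f x) * grad f x b * grad f x d
      + (1 / 4) * inner₂ (D.news I (ub + f x)) (hess f) x
  N := fun ub x a =>
    D.N (ub + f x) x a + 3 * D.m (ub + f x) x * grad f x a
      - (3 / 4) * ∑ b, curlDiv (D.C (ub + f x)) x b a * grad f x b
  C := fun ub x a b =>
    D.C (ub + f x) x a b - 2 * hess f x a b + lap f x * metric x a b

/-! ### The Chen-Wang-Yau angular momentum and center of mass -/

/-- The CWY angular momentum at retarded time `u`,
`J^k = ∫ ε^{AB} ∇_B X^k (N_A - ¼ C_{AB} ∇_D C^{DB} - c ∇_A m)`,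
where `c` is the closed potential of `C_{AB}(u, ·)`. -/
def Fields.angularMomentum (D : Fields) (u : ℝ) (c : S2 → ℝ) (k : Fin 3) : ℝ :=
  ∫ x, ∑ a, rot k x a *
    (D.N u x a - (1 / 4) * ∑ b, D.C u x a b * div₂ (D.C u) x b - c x * grad (D.m u) x a) ∂area

/-- The CWY center of mass at retarded time `u`,
`C^k = ∫ ∇^A X^k [N_A - u ∇_A m - ¼ C_{AB} ∇_D C^{DB} - (1/16) ∇_A (C^{DE} C_{DE}) - c ∇_A m
  + 2 ε_{AB} (∇^B c̲) m] + ∫ (3 X^k c m - ¼ X^k ∇_A F̲^{AB} ∇^D F̲_{DB})`,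
where `c, c̲` are the potentials of `C_{AB}(u, ·)` and `F̲` is its co-closed part. -/
def Fields.centerOfMass (D : Fields) (u : ℝ) (c cb : S2 → ℝ) (k : Fin 3) : ℝ :=
  (∫ x, ∑ a, grad (coord k) x a *
    (D.N u x a - u * grad (D.m u) x a - (1 / 4) * ∑ b, D.C u x a b * div₂ (D.C u) x b
      - (1 / 16) * grad (inner₂ (D.C u) (D.C u)) x a - c x * grad (D.m u) x a
      + 2 * (∑ b, eps x a b * grad cb x b) * D.m u x) ∂area)
  + ∫ x, (3 * coord k x * c x * D.m u x
      - (1 / 4) * coord k x *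
        ∑ b, div₂ (coclosedPart cb) x b * div₂ (coclosedPart cb) x b) ∂area

end NullInfinity

end

/-!
All computations take place in an algebra `A` of functions with three derivations `D a` (the
Cartesian components of the gradient) and an integral, subject to the few identities that the
sphere satisfies; smooth functions on `S²` form such an algebra.

For vanishing news, `m` and `C` do not depend on `u` and `N` is affine in `u`, so `(ū, x)` is
related to a fixed slice `u` by the supertranslation with `τ = (ū - u) + f`. The potentials are
unique: if `∇² c - ½ Δc σ + F̲ = 0`, then its divergence gives `∇(Δ + 2)c` plus a rotated gradient
of `(Δ + 2)c̲`, up to a factor `½`, whence both vanish and `c`, `c̲` have only modes `ℓ ≤ 1`. Since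
the shear changes by `-2 ∇²f + Δf σ`, which does not see the modes `ℓ ≤ 1`, the new potentials are
`c - 2 (f - f_{ℓ≤1})` and `c̲`. The vector fields `Y^k` and `∇X^k` are conformal Killing fields, and
integrating by parts against them makes the terms of the charges that mix the shear and `τ` cancel;
only the pairings of `m` with `f_{ℓ≤1}` remain. Conservation in `u` is the case `f = 0`.
-/

noncomputable section

namespace NullInfinity

/-- The tangential differential calculus of the unit sphere in Cartesian components, abstracted
from the algebra `A` of smooth functions it acts on: the coordinates `x a`, the components `D a` of
the gradient and the integral `int`. The components `D a` are derivations which commute only up to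
the first-order terms of `D_comm`, and integrating them by parts produces the mean curvature `2`. -/
structure TangentialCalculus (A : Type*) [CommRing A] [Algebra ℝ A] where
  x : Fin 3 → A
  D : Fin 3 → Derivation ℝ A A
  int : A →ₗ[ℝ] ℝ
  sum_x_mul_x : ∑ a, x a * x a = 1
  D_x : ∀ a b, D a (x b) = (if a = b then 1 else 0) - x a * x b
  sum_x_mul_D : ∀ f, ∑ a, x a * D a f = 0
  D_comm : ∀ a b f, D a (D b f) = D b (D a f) + x a * D b f - x b * D a f
  int_D : ∀ a f, int (D a f) = 2 * int (x a * f)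
  int_one : int 1 = 4 * Real.pi
  int_mul_self_nonneg : ∀ f, 0 ≤ int (f * f)
  eq_zero_of_int_mul_self : ∀ f, int (f * f) = 0 → f = 0
  eq_const_of_D_eq_zero : ∀ f, (∀ a, D a f = 0) → ∃ r : ℝ, f = algebraMap ℝ A r

namespace TangentialCalculus

variable {A : Type*} [CommRing A] [Algebra ℝ A] (S : TangentialCalculus A)

/-! ### Tangent fields and integration by parts -/

/-- One-forms on the sphere, as fields of vectors in `ℝ³` without radial component. -/
def IsTangent (w : Fin 3 → A) : Prop := ∑ a, S.x a * w a = 0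

/-- The round metric, which is also the tangential projection. -/
def metric (a b : Fin 3) : A := (if a = b then 1 else 0) - S.x a * S.x b

/-- The area form `ε(v, w) = det (x, v, w)`. -/
def eps (a b : Fin 3) : A :=
  (!![0, S.x 2, -S.x 1; -S.x 2, 0, S.x 0; S.x 1, -S.x 0, 0] : Matrix (Fin 3) (Fin 3) A) a b

/-- The gradient of a function. -/
def grad : A →ₗ[ℝ] Fin 3 → A := LinearMap.pi fun a => (S.D a : A →ₗ[ℝ] A)

/-- The covariant derivative `∇_a w_b` of a tangent field `w`: the second term of
`D_a w_b + x_b w_a` removes the component of `D_a w` along `x`. -/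
def covDeriv₁ : (Fin 3 → A) →ₗ[ℝ] Fin 3 → Fin 3 → A where
  toFun w a b := S.D a (w b) + S.x b * w a
  map_add' v w := by ext a b; simp only [Pi.add_apply, map_add]; ring
  map_smul' r w := by ext a b; simp

/-- The divergence of a tangent field. -/
def div₁ : (Fin 3 → A) →ₗ[ℝ] A := ∑ a, (S.D a : A →ₗ[ℝ] A) ∘ₗ LinearMap.proj a

/-- The divergence of a symmetric traceless tangential 2-tensor. -/
def div₂ : (Fin 3 → Fin 3 → A) →ₗ[ℝ] Fin 3 → A :=
  LinearMap.pi fun b => S.div₁ ∘ₗ LinearMap.pi fun a => LinearMap.proj b ∘ₗ LinearMap.proj a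

/-- The Laplacian. -/
def lap : A →ₗ[ℝ] A := S.div₁ ∘ₗ S.grad

/-- The covariant Hessian. -/
def hess : A →ₗ[ℝ] Fin 3 → Fin 3 → A := S.covDeriv₁ ∘ₗ S.grad

theorem grad_apply (f : A) (a : Fin 3) : S.grad f a = S.D a f := rfl

theorem covDeriv₁_apply (w : Fin 3 → A) (a b : Fin 3) :
    S.covDeriv₁ w a b = S.D a (w b) + S.x b * w a := rfl

theorem div₁_apply (w : Fin 3 → A) : S.div₁ w = ∑ a, S.D a (w a) := by simp [div₁]

theorem div₂_apply (T : Fin 3 → Fin 3 → A) (b : Fin 3) :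
    S.div₂ T b = ∑ a, S.D a (T a b) := S.div₁_apply _

theorem lap_apply (f : A) : S.lap f = ∑ a, S.D a (S.D a f) := S.div₁_apply _

theorem hess_apply (f : A) (a b : Fin 3) :
    S.hess f a b = S.D a (S.D b f) + S.x b * S.D a f := rfl

theorem D_mul (a : Fin 3) (f g : A) : S.D a (f * g) = f * S.D a g + g * S.D a f :=
  (S.D a).leibniz f g

theorem D_x_eq_metric (a b : Fin 3) : S.D a (S.x b) = S.metric a b := S.D_x a b

theorem metric_comm (a b : Fin 3) : S.metric a b = S.metric b a := by
  simp only [metric, eq_comm (a := a), mul_comm (S.x a)]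

theorem isTangent_metric (b : Fin 3) : S.IsTangent fun a => S.metric a b := by
  simp only [IsTangent, metric, mul_sub, mul_ite, mul_one, mul_zero, Finset.sum_sub_distrib,
    Finset.sum_ite_eq', Finset.mem_univ, if_true, ← mul_assoc, ← Finset.sum_mul, S.sum_x_mul_x]
  ring

theorem sum_metric_self : ∑ a, S.metric a a = 2 := by
  simp only [metric, if_true, Finset.sum_sub_distrib, S.sum_x_mul_x]
  norm_num

theorem isTangent_grad (f : A) : S.IsTangent (S.grad f) := S.sum_x_mul_D f

theorem eps_comm (a b : Fin 3) : S.eps a b = - S.eps b a := by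
  fin_cases a <;> fin_cases b <;> simp [eps]

theorem isTangent_eps (b : Fin 3) : S.IsTangent fun a => S.eps a b := by
  simp only [IsTangent, Fin.sum_univ_three, eps]
  fin_cases b <;> simp <;> ring

theorem D_eps (c a b : Fin 3) :
    S.D c (S.eps a b) = - S.x a * S.eps c b - S.x b * S.eps a c := by
  have h := S.sum_x_mul_x
  rw [Fin.sum_univ_three] at h
  fin_cases a <;> fin_cases b <;> fin_cases c <;> simp [eps, S.D_x] <;> grind

theorem sum_eps_mul_eps (a b : Fin 3) : ∑ c, S.eps a c * S.eps b c = S.metric a b := by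
  have h := S.sum_x_mul_x
  rw [Fin.sum_univ_three] at h ⊢
  fin_cases a <;> fin_cases b <;> simp [eps, metric] <;> grind

namespace IsTangent

variable {S} {w : Fin 3 → A}

theorem sum_metric_mul (hw : S.IsTangent w) (a : Fin 3) : ∑ b, S.metric a b * w b = w a := by
  simp only [metric, sub_mul, ite_mul, one_mul, zero_mul, Finset.sum_sub_distrib,
    Finset.sum_ite_eq, Finset.mem_univ, if_true, mul_assoc, ← Finset.mul_sum]
  rw [hw, mul_zero, sub_zero]

theorem sum_x_mul_D (hw : S.IsTangent w) (a : Fin 3) : ∑ b, S.x b * S.D a (w b) = - w a := by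
  have h := congrArg (S.D a) hw
  simp only [map_sum, D_mul, D_x_eq_metric, Finset.sum_add_distrib, map_zero] at h
  have hm := hw.sum_metric_mul a
  simp only [mul_comm] at h hm ⊢
  linear_combination h - hm

theorem mul_left (hw : S.IsTangent w) (f : A) : S.IsTangent fun a => f * w a := by
  simp only [IsTangent, mul_left_comm, ← Finset.mul_sum]
  rw [hw, mul_zero]

theorem int_div₁ (hw : S.IsTangent w) : S.int (S.div₁ w) = 0 := by
  rw [div₁_apply, map_sum]
  simp only [S.int_D]
  rw [← Finset.mul_sum, ← map_sum, hw, map_zero, mul_zero]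

theorem int_sum_mul_D (hw : S.IsTangent w) (f : A) :
    S.int (∑ a, w a * S.D a f) = - S.int (f * S.div₁ w) := by
  rw [eq_neg_iff_add_eq_zero, ← map_add, ← (hw.mul_left f).int_div₁]
  congr 1
  simp only [div₁_apply, D_mul, Finset.sum_add_distrib, Finset.mul_sum]
  ring

end IsTangent

/-! ### Symmetric traceless tensors -/

/-- Symmetric, traceless and tangential 2-tensors. -/
structure IsSTT (T : Fin 3 → Fin 3 → A) : Prop where
  symm : ∀ a b, T a b = T b a
  tangent : ∀ b, S.IsTangent fun a => T a b
  traceless : ∑ a, T a a = 0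

/-- The rotated gradient `ε^{AB} ∇_B f`. -/
def rotGrad (f : A) (a : Fin 3) : A := ∑ b, S.eps a b * S.D b f

/-- Twice the trace-free part of the Hessian: a closed shear with potential `f` is
`(1 / 2) • hessTF f`, and a supertranslation by `f` subtracts `hessTF f` from the shear. -/
def hessTF : A →ₗ[ℝ] Fin 3 → Fin 3 → A where
  toFun f a b := 2 * S.hess f a b - S.metric a b * S.lap f
  map_add' f g := by ext a b; simp only [map_add, Pi.add_apply]; ring
  map_smul' r f := by ext a b; simp [smul_sub]

/-- Twice the co-closed symmetric traceless tensor with a given potential. -/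
def rotHess : A →ₗ[ℝ] Fin 3 → Fin 3 → A where
  toFun f a b := ∑ e, (S.eps a e * S.hess f e b + S.eps b e * S.hess f e a)
  map_add' f g := by
    ext a b
    simp only [map_add, Pi.add_apply, mul_add, ← Finset.sum_add_distrib]
    exact Finset.sum_congr rfl fun e _ => by ring
  map_smul' r f := by ext a b; simp [Finset.smul_sum]

theorem hessTF_apply (f : A) (a b : Fin 3) :
    S.hessTF f a b = 2 * S.hess f a b - S.metric a b * S.lap f := rfl

theorem rotHess_apply (f : A) (a b : Fin 3) :
    S.rotHess f a b = ∑ e, (S.eps a e * S.hess f e b + S.eps b e * S.hess f e a) := rfl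

theorem hess_symm (f : A) (a b : Fin 3) : S.hess f a b = S.hess f b a := by
  rw [hess_apply, hess_apply, S.D_comm a b]
  ring

theorem isTangent_hess (f : A) (b : Fin 3) : S.IsTangent fun a => S.hess f a b := by
  have hD := S.sum_x_mul_D (S.D b f)
  have hx := (S.isTangent_grad f).mul_left (S.x b)
  simp only [IsTangent, hess_apply, mul_add, Finset.sum_add_distrib] at hx ⊢
  rw [hD, zero_add]
  exact hx

theorem trace_hess (f : A) : ∑ a, S.hess f a a = S.lap f := by
  simp only [hess_apply, lap_apply, Finset.sum_add_distrib, S.sum_x_mul_D, add_zero]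

/-- The term `D b f` is the Ricci curvature of the unit sphere. -/
theorem div₂_hess (f : A) (b : Fin 3) :
    S.div₂ (S.hess f) b = S.D b (S.lap f) + S.D b f - S.x b * S.lap f := by
  have hf := (S.isTangent_grad f).sum_x_mul_D b
  have hm := (S.isTangent_grad f).sum_metric_mul b
  have hDf := S.sum_x_mul_D (S.D b f)
  have hx := S.sum_x_mul_x
  have htr := S.sum_metric_self
  have hcomm : ∀ a, S.D a (S.D a (S.D b f)) = S.D b (S.D a (S.D a f)) + S.x a * S.D b (S.D a f)
      - S.x b * S.D a (S.D a f) + S.D a (S.x a * S.D b f - S.x b * S.D a f) := fun a => by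
    rw [S.D_comm a b f, add_sub_assoc, map_add, S.D_comm a b (S.D a f)]
  simp only [div₂_apply, hess_apply, lap_apply, grad_apply, Fin.sum_univ_three, map_add, hcomm,
    map_sub, D_mul, D_x_eq_metric, S.metric_comm _ b] at hf hm hDf hx htr ⊢
  linear_combination hf + hDf + S.D b f * htr

theorem D_two (a : Fin 3) : S.D a (2 : A) = 0 := by
  simpa using (S.D a).map_natCast 2

theorem D_metric (c a b : Fin 3) :
    S.D c (S.metric a b) = - S.x a * S.metric c b - S.x b * S.metric c a := by
  have hconst : S.D c (if a = b then 1 else 0 : A) = 0 := by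
    rw [apply_ite (S.D c), map_zero, Derivation.map_one_eq_zero, ite_self]
  calc S.D c (S.metric a b) = S.D c ((if a = b then 1 else 0) - S.x a * S.x b) := rfl
    _ = _ := by rw [map_sub, hconst, D_mul, D_x_eq_metric, D_x_eq_metric]; ring

theorem sum_D_metric (b : Fin 3) : ∑ a, S.D a (S.metric a b) = -2 * S.x b := by
  have hx : ∑ a, S.x a * S.metric a b = 0 := S.isTangent_metric b
  simp only [D_metric, neg_mul, Finset.sum_sub_distrib, Finset.sum_neg_distrib, ← Finset.mul_sum,
    hx, S.sum_metric_self]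
  ring

theorem div₂_hessTF (f : A) (b : Fin 3) : S.div₂ (S.hessTF f) b = S.D b (S.lap f + 2 * f) := by
  have hh := S.div₂_hess f b
  have hm := (S.isTangent_grad (S.lap f)).sum_metric_mul b
  have hD := S.sum_D_metric b
  simp only [div₂_apply, grad_apply, hessTF_apply, Fin.sum_univ_three, map_sub, map_add, D_mul,
    D_two, S.metric_comm b] at hh hm hD ⊢
  linear_combination 2 * hh - hm - S.lap f * hD

theorem isSTT_hessTF (f : A) : S.IsSTT (S.hessTF f) where
  symm a b := by rw [hessTF_apply, hessTF_apply, S.hess_symm f a b, S.metric_comm a b]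
  tangent b := by
    have hh := S.isTangent_hess f b
    have hm := S.isTangent_metric b
    simp only [IsTangent, hessTF_apply, Fin.sum_univ_three] at hh hm ⊢
    linear_combination 2 * hh - S.lap f * hm
  traceless := by
    have hh := S.trace_hess f
    have hm := S.sum_metric_self
    simp only [hessTF_apply, Fin.sum_univ_three] at hh hm ⊢
    linear_combination 2 * hh - S.lap f * hm

theorem eps_self (a : Fin 3) : S.eps a a = 0 := by
  fin_cases a <;> simp [eps]

theorem sum_eps_mul_eq_zero_of_symm {T : Fin 3 → Fin 3 → A} (hT : ∀ a b, T a b = T b a) :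
    ∑ a, ∑ b, S.eps a b * T a b = 0 := by
  simp only [Fin.sum_univ_three, S.eps_comm 1 0, S.eps_comm 2 0, S.eps_comm 2 1, S.eps_self,
    hT 1 0, hT 2 0, hT 2 1]
  ring

theorem sum_eps_mul_x (a : Fin 3) : ∑ b, S.eps a b * S.x b = 0 := by
  have h : ∑ b, S.x b * S.eps b a = 0 := S.isTangent_eps a
  simp only [S.eps_comm _ a, mul_neg, Finset.sum_neg_distrib, neg_eq_zero] at h
  simpa only [mul_comm] using h

theorem sum_metric_mul_eps (a b : Fin 3) : ∑ c, S.metric a c * S.eps c b = S.eps a b :=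
  (S.isTangent_eps b).sum_metric_mul a

theorem isSTT_rotHess (f : A) : S.IsSTT (S.rotHess f) where
  symm a b := by simp only [rotHess_apply, add_comm]
  tangent b := by
    have he := fun e => S.isTangent_eps e
    have hh : ∀ e, ∑ a, S.x a * S.hess f e a = 0 := fun e => by
      simpa only [IsTangent, S.hess_symm f e] using S.isTangent_hess f e
    simp only [IsTangent, rotHess_apply, Fin.sum_univ_three] at he hh ⊢
    linear_combination S.hess f 0 b * he 0 + S.hess f 1 b * he 1 + S.hess f 2 b * he 2
      + S.eps b 0 * hh 0 + S.eps b 1 * hh 1 + S.eps b 2 * hh 2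
  traceless := by
    have h := S.sum_eps_mul_eq_zero_of_symm fun a e => S.hess_symm f e a
    simp only [rotHess_apply, ← two_mul, ← Finset.mul_sum]
    rw [h, mul_zero]

theorem sum_D_eps (b : Fin 3) : ∑ a, S.D a (S.eps a b) = 0 := by
  have he : ∑ a, S.x a * S.eps a b = 0 := S.isTangent_eps b
  simp only [S.D_eps, S.eps_self, neg_mul, Finset.sum_neg_distrib, mul_zero, sub_zero, he, neg_zero]

theorem sum_eps_mul_D_D (f : A) : ∑ a, ∑ b, S.eps a b * S.D a (S.D b f) = 0 := by
  simp only [Fin.sum_univ_three, S.D_comm 1 0, S.D_comm 2 0, S.D_comm 2 1]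
  simp only [eps, Matrix.of_apply, Matrix.cons_val]
  ring

theorem sum_D_eps_mul_hess (f : A) (b : Fin 3) :
    ∑ a, S.D a (∑ e, S.eps a e * S.hess f e b) = ∑ e, S.eps b e * S.D e f := by
  have hbf := S.sum_eps_mul_D_D (S.D b f)
  have hf := S.sum_eps_mul_D_D f
  have he := fun e => S.sum_D_eps e
  have hm := fun e => S.sum_metric_mul_eps b e
  simp only [hess_apply, Fin.sum_univ_three, map_add, D_mul, D_x_eq_metric, S.metric_comm _ b]
    at hbf hf he hm ⊢
  linear_combination hbf + S.x b * hf + (S.D 0 (S.D b f) + S.x b * S.D 0 f) * he 0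
    + (S.D 1 (S.D b f) + S.x b * S.D 1 f) * he 1 + (S.D 2 (S.D b f) + S.x b * S.D 2 f) * he 2
    + S.D 0 f * hm 0 + S.D 1 f * hm 1 + S.D 2 f * hm 2

theorem sum_D_eps_mul_hess' (f : A) (b : Fin 3) :
    ∑ a, S.D a (∑ e, S.eps b e * S.hess f e a) = ∑ e, S.eps b e * S.D e (S.lap f + f) := by
  have hdiv : ∀ e, ∑ a, S.D a (S.hess f e a) = S.D e (S.lap f) + S.D e f - S.x e * S.lap f :=
    fun e => by simpa only [div₂_apply, S.hess_symm f _ e] using S.div₂_hess f e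
  have htan : ∀ a, ∑ e, S.x e * S.hess f e a = 0 := S.isTangent_hess f
  have hsymm := S.sum_eps_mul_eq_zero_of_symm fun a e => S.hess_symm f e a
  have hx := S.sum_eps_mul_x b
  simp only [Fin.sum_univ_three, map_add, D_mul, D_eps] at hdiv htan hsymm hx ⊢
  linear_combination S.eps b 0 * (hdiv 0 - htan 0) + S.eps b 1 * (hdiv 1 - htan 1)
    + S.eps b 2 * (hdiv 2 - htan 2) - S.lap f * hx - S.x b * hsymm

theorem div₂_rotHess (f : A) (b : Fin 3) :
    S.div₂ (S.rotHess f) b = S.rotGrad (S.lap f + 2 * f) b := by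
  simp only [div₂_apply, rotGrad, rotHess_apply, Finset.sum_add_distrib, map_add]
  rw [S.sum_D_eps_mul_hess, S.sum_D_eps_mul_hess', ← Finset.sum_add_distrib]
  refine Finset.sum_congr rfl fun e _ => ?_
  simp only [two_mul, map_add]
  ring

namespace IsSTT

variable {S} {T T' : Fin 3 → Fin 3 → A}

theorem add (hT : S.IsSTT T) (hT' : S.IsSTT T') : S.IsSTT (T + T') where
  symm a b := by simp only [Pi.add_apply, hT.symm a b, hT'.symm a b]
  tangent b := by
    have h : ∑ a, S.x a * T a b = 0 := hT.tangent b
    have h' : ∑ a, S.x a * T' a b = 0 := hT'.tangent b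
    simp only [IsTangent, Pi.add_apply, mul_add, Finset.sum_add_distrib, h, h', add_zero]
  traceless := by
    simp only [Pi.add_apply, Finset.sum_add_distrib, hT.traceless, hT'.traceless, add_zero]

theorem sub (hT : S.IsSTT T) (hT' : S.IsSTT T') : S.IsSTT (T - T') where
  symm a b := by simp only [Pi.sub_apply, hT.symm a b, hT'.symm a b]
  tangent b := by
    have h : ∑ a, S.x a * T a b = 0 := hT.tangent b
    have h' : ∑ a, S.x a * T' a b = 0 := hT'.tangent b
    simp only [IsTangent, Pi.sub_apply, mul_sub, Finset.sum_sub_distrib, h, h', sub_zero]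
  traceless := by
    simp only [Pi.sub_apply, Finset.sum_sub_distrib, hT.traceless, hT'.traceless, sub_zero]

theorem smul (hT : S.IsSTT T) (r : ℝ) : S.IsSTT (r • T) where
  symm a b := by simp only [Pi.smul_apply, hT.symm a b]
  tangent b := by
    have h : ∑ a, S.x a * T a b = 0 := hT.tangent b
    simp only [IsTangent, Pi.smul_apply, mul_smul_comm, ← Finset.smul_sum, h, smul_zero]
  traceless := by simp only [Pi.smul_apply, ← Finset.smul_sum, hT.traceless, smul_zero]

theorem isTangent_row (hT : S.IsSTT T) (a : Fin 3) : S.IsTangent (T a) := by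
  simpa only [hT.symm _ a] using hT.tangent a

theorem isTangent_contract (hT : S.IsSTT T) (w : Fin 3 → A) :
    S.IsTangent fun a => ∑ b, T a b * w b := by
  have hx : ∀ b, ∑ a, S.x a * T a b = 0 := hT.tangent
  simp only [IsTangent, Finset.mul_sum, ← mul_assoc]
  rw [Finset.sum_comm]
  simp only [← Finset.sum_mul, hx, zero_mul, Finset.sum_const_zero]

theorem isTangent_div₂ (hT : S.IsSTT T) : S.IsTangent (S.div₂ T) := by
  have hx := fun a => (hT.isTangent_row a).sum_x_mul_D a
  have htr := hT.traceless
  simp only [IsTangent, div₂_apply, Fin.sum_univ_three] at hx htr ⊢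
  linear_combination hx 0 + hx 1 + hx 2 - htr

theorem sum_metric_mul (hT : S.IsSTT T) : ∑ a, ∑ b, S.metric a b * T a b = 0 := by
  rw [← hT.traceless]
  refine Finset.sum_congr rfl fun a _ => ?_
  simpa only [hT.symm _ a] using (hT.tangent a).sum_metric_mul a

theorem sum_mul_hessTF (hT : S.IsSTT T) (f : A) :
    ∑ a, ∑ b, T a b * S.hessTF f a b = 2 * ∑ a, ∑ b, T a b * S.hess f a b := by
  have hm := hT.sum_metric_mul
  simp only [hessTF_apply, Fin.sum_univ_three] at hm ⊢
  linear_combination - S.lap f * hm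

theorem int_mul_sum_mul_hess (hT : S.IsSTT T) (h f : A) :
    S.int (h * ∑ a, ∑ b, T a b * S.hess f a b) =
      - S.int (h * ∑ b, S.div₂ T b * S.D b f + ∑ a, ∑ b, T a b * S.D a h * S.D b f) := by
  have hw := (hT.isTangent_contract (S.grad f)).mul_left h
  have hx : ∀ a, ∑ b, S.x b * T a b = 0 := hT.isTangent_row
  rw [eq_neg_iff_add_eq_zero, ← map_add, ← hw.int_div₁]
  congr 1
  simp only [hess_apply, div₁_apply, div₂_apply, grad_apply, Fin.sum_univ_three, map_add, D_mul]
    at hx ⊢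
  linear_combination h * (S.D 0 f * hx 0 + S.D 1 f * hx 1 + S.D 2 f * hx 2)

end IsSTT

theorem eq_zero_of_int_sum_mul_self {ι : Type*} [Fintype ι] {w : ι → A}
    (h : S.int (∑ i, w i * w i) = 0) (i : ι) : w i = 0 := by
  rw [map_sum, Finset.sum_eq_zero_iff_of_nonneg fun i _ => S.int_mul_self_nonneg (w i)] at h
  exact S.eq_zero_of_int_mul_self _ (h i (Finset.mem_univ i))

theorem eq_zero_of_grad_eq_zero {f : A} (hf : S.grad f = 0) (hint : S.int f = 0) : f = 0 := by
  obtain ⟨r, rfl⟩ := S.eq_const_of_D_eq_zero f (congrFun hf)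
  refine S.eq_zero_of_int_mul_self _ ?_
  rw [← Algebra.smul_def, map_smul, hint, smul_zero]

theorem eq_zero_of_two_mul {f : A} (h : 2 * f = 0) : f = 0 := by
  have h' : (2 : ℝ) • f = 0 := by rw [Algebra.smul_def, map_ofNat, h]
  simpa using h'

/-! ### Uniqueness of shear potentials -/

/-- The functions without modes `ℓ ≤ 1`, where the shear potentials live. -/
def highModes : Submodule ℝ A :=
  LinearMap.ker S.int ⊓ ⨅ i, LinearMap.ker (S.int ∘ₗ LinearMap.mulRight ℝ (S.x i))

theorem mem_highModes {f : A} :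
    f ∈ S.highModes ↔ S.int f = 0 ∧ ∀ i, S.int (f * S.x i) = 0 := by
  simp [highModes]

theorem int_lap (f : A) : S.int (S.lap f) = 0 := (S.isTangent_grad f).int_div₁

theorem hessTF_eq_zero {f : A} (hf : S.lap f + 2 * f = 0) : S.hessTF f = 0 := by
  have hT := S.isSTT_hessTF f
  have hdiv : S.div₂ (S.hessTF f) = 0 := by
    ext b
    rw [div₂_hessTF, hf, map_zero, Pi.zero_apply]
  have hint : S.int (∑ i : Fin 3 × Fin 3, S.hessTF f i.1 i.2 * S.hessTF f i.1 i.2) = 0 := by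
    have h := hT.int_mul_sum_mul_hess 1 f
    simp only [hdiv, Derivation.map_one_eq_zero, Pi.zero_apply, one_mul, zero_mul, mul_zero,
      Finset.sum_const_zero, add_zero, map_zero, neg_zero] at h
    rw [Fintype.sum_prod_type, hT.sum_mul_hessTF, two_mul, map_add, h, add_zero]
  ext a b
  exact S.eq_zero_of_int_sum_mul_self hint (a, b)

theorem exists_eq_sum_smul_x {f : A} (hf : S.lap f + 2 * f = 0) :
    ∃ r : Fin 3 → ℝ, f = ∑ b, r b • S.x b := by
  have hconst : ∀ b a, S.D a (S.D b f + S.x b * f) = 0 := fun b a => by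
    apply eq_zero_of_two_mul
    have h : S.hessTF f a b = 0 := by rw [S.hessTF_eq_zero hf]; rfl
    rw [hessTF_apply, hess_apply] at h
    rw [map_add, D_mul, D_x_eq_metric]
    linear_combination h + S.metric a b * hf
  choose r hr using fun b => S.eq_const_of_D_eq_zero _ (hconst b)
  refine ⟨r, ?_⟩
  have hD := S.sum_x_mul_D f
  have hx := S.sum_x_mul_x
  simp only [Algebra.smul_def, ← hr, Fin.sum_univ_three] at hD hx ⊢
  linear_combination - hD - f * hx

theorem eq_zero_of_lap_add_two_mul {f : A} (hf : S.grad (S.lap f + 2 * f) = 0)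
    (hhigh : f ∈ S.highModes) : f = 0 := by
  obtain ⟨hint, hintx⟩ := S.mem_highModes.1 hhigh
  have hzero : S.lap f + 2 * f = 0 := S.eq_zero_of_grad_eq_zero hf <| by
    rw [map_add, int_lap, two_mul, map_add, hint, add_zero, add_zero]
  obtain ⟨r, hr⟩ := S.exists_eq_sum_smul_x hzero
  refine S.eq_zero_of_int_mul_self f ?_
  nth_rewrite 2 [hr]
  simp only [Finset.mul_sum, map_sum, mul_smul_comm, map_smul, hintx, smul_zero,
    Finset.sum_const_zero]

theorem isTangent_rotGrad (f : A) : S.IsTangent (S.rotGrad f) := by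
  have he : ∀ b, ∑ a, S.x a * S.eps a b = 0 := S.isTangent_eps
  simp only [IsTangent, rotGrad, Finset.mul_sum, ← mul_assoc]
  rw [Finset.sum_comm]
  simp only [← Finset.sum_mul, he, zero_mul, Finset.sum_const_zero]

theorem div₁_rotGrad (f : A) : S.div₁ (S.rotGrad f) = 0 := by
  have he := fun b => S.sum_D_eps b
  have hf := S.sum_eps_mul_D_D f
  simp only [div₁_apply, rotGrad, Fin.sum_univ_three, map_add, D_mul] at he hf ⊢
  linear_combination hf + S.D 0 f * he 0 + S.D 1 f * he 1 + S.D 2 f * he 2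

theorem grad_eq_zero_of_rotGrad_eq_zero {f : A} (hf : S.rotGrad f = 0) : S.grad f = 0 := by
  have hzero : ∀ c, ∑ b, S.eps b c * S.D b f = 0 := fun c => by
    simpa only [rotGrad, S.eps_comm c, neg_mul, Finset.sum_neg_distrib, neg_eq_zero, Pi.zero_apply]
      using congrFun hf c
  ext a
  calc S.grad f a = ∑ b, (∑ c, S.eps a c * S.eps b c) * S.grad f b := by
        simp only [sum_eps_mul_eps, (S.isTangent_grad f).sum_metric_mul]
    _ = ∑ c, S.eps a c * ∑ b, S.eps b c * S.D b f := by
        simp only [Finset.sum_mul, Finset.mul_sum, mul_assoc, grad_apply]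
        exact Finset.sum_comm
    _ = 0 := by simp only [hzero, mul_zero, Finset.sum_const_zero]

theorem eq_zero_of_hessTF_add_rotHess {c cb : A} (h : S.hessTF c + S.rotHess cb = 0)
    (hc : c ∈ S.highModes) (hcb : cb ∈ S.highModes) : c = 0 ∧ cb = 0 := by
  set p := S.lap c + 2 * c
  set q := S.lap cb + 2 * cb
  have hdiv : S.grad p + S.rotGrad q = 0 := by
    ext b
    have hb := congrFun (congrArg S.div₂ h) b
    rwa [map_add, Pi.add_apply, div₂_hessTF, div₂_rotHess, map_zero] at hb
  have hp0 : S.grad p = 0 := by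
    have horth := (S.isTangent_rotGrad q).int_sum_mul_D p
    rw [div₁_rotGrad, mul_zero, map_zero, neg_zero, eq_neg_of_add_eq_zero_right hdiv] at horth
    ext a
    refine S.eq_zero_of_int_sum_mul_self ?_ a
    simpa [grad_apply] using horth
  have hq0 : S.rotGrad q = 0 := by rwa [hp0, zero_add] at hdiv
  exact ⟨S.eq_zero_of_lap_add_two_mul hp0 hc,
    S.eq_zero_of_lap_add_two_mul (S.grad_eq_zero_of_rotGrad_eq_zero hq0) hcb⟩

/-! ### Conformal Killing fields and the shear -/

/-- The conformal Killing equation `∇_a V_b = φ σ_ab + κ ε_ab` for a tangent field `V` on the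
sphere. The two families that generate the Lorentz algebra, the rotations and the gradients of the
coordinates, are the cases `φ = 0` and `κ = 0`. -/
structure IsConformalKilling (V : Fin 3 → A) (φ κ : A) : Prop where
  tangent : S.IsTangent V
  covDeriv₁_eq : ∀ a b, S.covDeriv₁ V a b = φ * S.metric a b + κ * S.eps a b

/-- The rotation field `ε^{AB} ∇_B X^k`, in the simplified form `ε^A_k`. -/
def rot (k a : Fin 3) : A := S.eps a k

theorem isConformalKilling_rot (k : Fin 3) : S.IsConformalKilling (S.rot k) 0 (S.x k) where
  tangent := S.isTangent_eps k
  covDeriv₁_eq a b := by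
    rw [covDeriv₁_apply, rot, rot, D_eps, S.eps_comm b a]
    ring

theorem isConformalKilling_grad_x (k : Fin 3) :
    S.IsConformalKilling (S.grad (S.x k)) (- S.x k) 0 where
  tangent := S.isTangent_grad (S.x k)
  covDeriv₁_eq a b := by
    rw [covDeriv₁_apply, grad_apply, grad_apply, D_x_eq_metric, D_x_eq_metric, D_metric]
    ring

/-- The vector field `C_{AB} ∇_D C^{DB}`. -/
def quad (C : Fin 3 → Fin 3 → A) (a : Fin 3) : A := ∑ b, C a b * S.div₂ C b

/-- The antisymmetric derivative `∇_b t_a - ∇_a t_b` of a one-form. -/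
def curl (t : Fin 3 → A) (b a : Fin 3) : A := S.covDeriv₁ t b a - S.covDeriv₁ t a b

theorem curl_antisymm (t : Fin 3 → A) (a b : Fin 3) : S.curl t b a = - S.curl t a b :=
  (neg_sub _ _).symm

theorem IsTangent.sum_x_mul_curl {S : TangentialCalculus A} {t : Fin 3 → A} (ht : S.IsTangent t)
    (a : Fin 3) : ∑ b, S.x b * S.curl t b a = 0 := by
  have ht0 : ∑ b, S.x b * t b = 0 := ht
  have hr := S.sum_x_mul_D (t a)
  have hx := ht.sum_x_mul_D a
  have hxx := S.sum_x_mul_x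
  simp only [curl, covDeriv₁_apply, Fin.sum_univ_three] at ht0 hr hx hxx ⊢
  linear_combination hr + S.x a * ht0 - hx - t a * hxx

/-- The change of the shear-dependent part of the angular momentum aspect integrand under a
supertranslation by `f`, up to the factor `-1/4`. -/
def shearDensity (C : Fin 3 → Fin 3 → A) (f : A) (a : Fin 3) : A :=
  f * S.div₂ (S.curl (S.div₂ C)) a + 3 * ∑ b, S.curl (S.div₂ C) b a * S.D b f
    + (S.quad (C - S.hessTF f) a - S.quad C a)

theorem int_eq_of_sub_eq_div₁ {g g' : A} {w : Fin 3 → A} (hw : S.IsTangent w)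
    (h : g - g' = S.div₁ w) : S.int g = S.int g' := by
  rw [← sub_eq_zero, ← map_sub, h, hw.int_div₁]

namespace IsConformalKilling

variable {S} {V : Fin 3 → A} {φ κ : A}

theorem D_eq (hV : S.IsConformalKilling V φ κ) (a b : Fin 3) :
    S.D a (V b) = φ * S.metric a b + κ * S.eps a b - S.x b * V a := by
  rw [← hV.covDeriv₁_eq, covDeriv₁_apply, add_sub_cancel_right]

theorem div₁_eq (hV : S.IsConformalKilling V φ κ) : S.div₁ V = 2 * φ := by
  have ht : ∑ a, S.x a * V a = 0 := hV.tangent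
  simp only [div₁_apply, hV.D_eq, Finset.sum_sub_distrib, Finset.sum_add_distrib, ← Finset.mul_sum,
    S.sum_metric_self, eps_self, ht]
  simp [mul_comm]

theorem int_sum_mul_D (hV : S.IsConformalKilling V φ κ) (f : A) :
    S.int (∑ a, V a * S.D a f) = -2 * S.int (φ * f) := by
  rw [hV.tangent.int_sum_mul_D, hV.div₁_eq, show f * (2 * φ) = (2 : ℝ) • (φ * f) by
    rw [Algebra.smul_def, map_ofNat]; ring, map_smul, smul_eq_mul]
  ring

theorem sum_mul_D_eq (hV : S.IsConformalKilling V φ κ) {T : Fin 3 → Fin 3 → A} (hT : S.IsSTT T) :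
    ∑ a, ∑ b, T a b * S.D a (V b) = 0 := by
  have hx : ∀ a, ∑ b, S.x b * T a b = 0 := hT.isTangent_row
  have hm := hT.sum_metric_mul
  have he := S.sum_eps_mul_eq_zero_of_symm hT.symm
  simp only [hV.D_eq, Fin.sum_univ_three] at hx hm he ⊢
  linear_combination φ * hm + κ * he - V 0 * hx 0 - V 1 * hx 1 - V 2 * hx 2

theorem sum_curl_mul_D (hV : S.IsConformalKilling V φ κ) {t : Fin 3 → A} (ht : S.IsTangent t) :
    ∑ a, ∑ b, S.curl t b a * S.D b (V a) = 2 * κ * ∑ a, ∑ b, S.eps b a * S.D b (t a) := by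
  have hx := ht.sum_x_mul_curl
  have hex := S.sum_eps_mul_x
  have hsymm := S.sum_eps_mul_eq_zero_of_symm (T := fun b a =>
    S.covDeriv₁ t b a + S.covDeriv₁ t a b) fun _ _ => add_comm _ _
  simp only [hV.D_eq, curl, covDeriv₁_apply, Fin.sum_univ_three, S.metric_comm 1 0,
    S.metric_comm 2 0, S.metric_comm 2 1] at hx hex hsymm ⊢
  linear_combination V 0 * hx 0 + V 1 * hx 1 + V 2 * hx 2 - κ * hsymm
    + 2 * κ * (t 0 * hex 0 + t 1 * hex 1 + t 2 * hex 2)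

theorem int_sum_mul_div₂_curl (hV : S.IsConformalKilling V φ κ) {t : Fin 3 → A}
    (ht : S.IsTangent t) (f : A) :
    S.int (∑ a, V a * (f * S.div₂ (S.curl t) a + ∑ b, S.curl t b a * S.D b f)) =
      S.int (∑ a, ∑ b, 2 * (S.eps b a * t a) * S.D b (f * κ)) := by
  have hw : S.IsTangent fun b => ∑ a, f * (V a * S.curl t b a - 2 * κ * (S.eps b a * t a)) := by
    have hx := ht.sum_x_mul_curl
    have he : ∀ a, ∑ b, S.x b * S.eps b a = 0 := S.isTangent_eps
    simp only [IsTangent, Fin.sum_univ_three] at hx he ⊢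
    linear_combination f * (V 0 * hx 0 + V 1 * hx 1 + V 2 * hx 2
      - 2 * κ * (t 0 * he 0 + t 1 * he 1 + t 2 * he 2))
  have hcurl := hV.sum_curl_mul_D ht
  have he := S.sum_D_eps
  refine S.int_eq_of_sub_eq_div₁ hw ?_
  simp only [div₁_apply, div₂_apply, D_mul, Fin.sum_univ_three, map_add, map_sub, D_two]
    at hcurl he ⊢
  linear_combination -f * hcurl + 2 * f * κ * (t 0 * he 0 + t 1 * he 1 + t 2 * he 2)

theorem int_sum_mul_sum_curl_mul_D (hV : S.IsConformalKilling V φ κ) {t : Fin 3 → A}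
    (ht : S.IsTangent t) (f : A) :
    S.int (∑ a, V a * ∑ b, S.curl t b a * S.D b f) =
      S.int (∑ a, ∑ b, (V a * t b * S.D a (S.D b f) - κ * (S.eps b a * t a) * S.D b f)
        - S.lap f * ∑ a, V a * t a + φ * ∑ a, t a * S.D a f) := by
  have hw : S.IsTangent fun b => (∑ a, V a * t a) * S.D b f - (∑ a, t a * S.D a f) * V b := by
    have hf := S.sum_x_mul_D f
    have hx : ∑ a, S.x a * V a = 0 := hV.tangent
    simp only [IsTangent, Fin.sum_univ_three] at hf hx ⊢
    linear_combination (V 0 * t 0 + V 1 * t 1 + V 2 * t 2) * hf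
      - (t 0 * S.D 0 f + t 1 * S.D 1 f + t 2 * S.D 2 f) * hx
  have hDV : ∑ a, ∑ b, t a * S.D b (V a) * S.D b f =
      φ * (∑ a, t a * S.D a f) + κ * ∑ a, ∑ b, S.eps b a * t a * S.D b f := by
    have hx : ∑ a, S.x a * t a = 0 := ht
    have hm := ht.sum_metric_mul
    simp only [hV.D_eq, Fin.sum_univ_three] at hx hm ⊢
    linear_combination φ * (S.D 0 f * hm 0 + S.D 1 f * hm 1 + S.D 2 f * hm 2)
      - (V 0 * S.D 0 f + V 1 * S.D 1 f + V 2 * S.D 2 f) * hx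
  have hx : ∑ a, S.x a * V a = 0 := hV.tangent
  have hf := S.sum_x_mul_D f
  have hdiv := hV.div₁_eq
  refine S.int_eq_of_sub_eq_div₁ hw ?_
  simp only [div₁_apply, lap_apply, curl, covDeriv₁_apply, D_mul, Fin.sum_univ_three, map_add,
    map_sub] at hDV hx hf hdiv ⊢
  linear_combination (t 0 * S.D 0 f + t 1 * S.D 1 f + t 2 * S.D 2 f) * (hdiv + hx) - hDV
    - (t 0 * V 0 + t 1 * V 1 + t 2 * V 2) * hf

theorem int_mul_sum_mul_D_self (hV : S.IsConformalKilling V φ κ) (g : A) :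
    S.int (g * ∑ a, V a * S.D a g) = - S.int (φ * g ^ 2) := by
  have h := hV.int_sum_mul_D (g ^ 2)
  have hD : ∑ a, V a * S.D a (g ^ 2) = g * ∑ a, V a * S.D a g + g * ∑ a, V a * S.D a g := by
    simp only [pow_two, D_mul, Fin.sum_univ_three]
    ring
  rw [hD, map_add] at h
  linarith

theorem int_sum_mul_quad_sub (hV : S.IsConformalKilling V φ κ) {C : Fin 3 → Fin 3 → A}
    (hC : S.IsSTT C) (f : A) :
    S.int (∑ a, V a * (S.quad (C - S.hessTF f) a - S.quad C a)) =
      S.int (2 * ((S.lap f + f) * ∑ a, V a * S.div₂ C a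
        - ∑ a, ∑ b, V a * S.div₂ C b * S.D a (S.D b f)) + φ * (S.lap f + 2 * f) ^ 2) := by
  have hC' := hC.sub (S.isSTT_hessTF f)
  have hw := (hC'.isTangent_contract V).mul_left (-(S.lap f + 2 * f))
  have hCV := hV.sum_mul_D_eq hC'
  have hm := hC.isTangent_div₂.sum_metric_mul
  have hx : ∑ b, S.x b * S.div₂ C b = 0 := hC.isTangent_div₂
  rw [map_add, ← neg_neg (S.int (φ * _ ^ 2)), ← hV.int_mul_sum_mul_D_self, ← sub_eq_add_neg,
    ← map_sub]
  refine S.int_eq_of_sub_eq_div₁ hw ?_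
  have hdiv : ∀ b, S.div₂ (C - S.hessTF f) b = S.div₂ C b - S.D b (S.lap f + 2 * f) := fun b => by
    rw [map_sub, Pi.sub_apply, div₂_hessTF]
  have hdiv' := fun b => (S.div₂_apply (C - S.hessTF f) b).symm.trans (hdiv b)
  have hCC' : ∀ a b, C a b = (C - S.hessTF f) a b + S.hessTF f a b := fun a b =>
    (sub_add_cancel _ _).symm
  have hsymm := hC'.symm
  set t := S.div₂ C
  set C' := C - S.hessTF f
  set g := S.lap f + 2 * f with hg
  simp only [quad, hCC', hessTF_apply, hess_apply, div₁_apply, hdiv, Fin.sum_univ_three, map_add,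
    map_neg, D_mul] at hdiv' hCV hm hx ⊢
  linear_combination g * (V 0 * hdiv' 0 + V 1 * hdiv' 1 + V 2 * hdiv' 2 + hCV)
    + S.lap f * (V 0 * hm 0 + V 1 * hm 1 + V 2 * hm 2)
    - 2 * (V 0 * S.D 0 f + V 1 * S.D 1 f + V 2 * S.D 2 f) * hx
    + (V 0 * t 0 + V 1 * t 1 + V 2 * t 2) * hg + (S.D 0 g * V 1 - S.D 1 g * V 0) * hsymm 0 1
    + (S.D 0 g * V 2 - S.D 2 g * V 0) * hsymm 0 2 + (S.D 1 g * V 2 - S.D 2 g * V 1) * hsymm 1 2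

theorem int_sum_mul_shearDensity (hV : S.IsConformalKilling V φ κ) {C : Fin 3 → Fin 3 → A}
    (hC : S.IsSTT C) (f : A) :
    S.int (∑ a, V a * S.shearDensity C f a) =
      S.int (2 * f * ∑ a, (V a + ∑ b, S.eps b a * S.D b κ) * S.div₂ C a
        + 2 * φ * ∑ a, S.div₂ C a * S.D a f + φ * (S.lap f + 2 * f) ^ 2) := by
  have ht := hC.isTangent_div₂
  calc S.int (∑ a, V a * S.shearDensity C f a)
      = S.int (∑ a, V a * (f * S.div₂ (S.curl (S.div₂ C)) a
          + ∑ b, S.curl (S.div₂ C) b a * S.D b f))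
        + (S.int (∑ a, V a * ∑ b, S.curl (S.div₂ C) b a * S.D b f)
        + S.int (∑ a, V a * ∑ b, S.curl (S.div₂ C) b a * S.D b f))
        + S.int (∑ a, V a * (S.quad (C - S.hessTF f) a - S.quad C a)) := by
        rw [← map_add, ← map_add, ← map_add]
        simp only [shearDensity, Fin.sum_univ_three]
        congr 1
        ring
    _ = _ := by
        rw [hV.int_sum_mul_div₂_curl ht, hV.int_sum_mul_sum_curl_mul_D ht,
          hV.int_sum_mul_quad_sub hC, ← map_add, ← map_add, ← map_add]
        simp only [D_mul, Fin.sum_univ_three]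
        congr 1
        ring

end IsConformalKilling

theorem IsConformalKilling.int_sum_mul_mul_D {S : TangentialCalculus A} {V : Fin 3 → A} {φ κ : A}
    (hV : S.IsConformalKilling V φ κ) {T : Fin 3 → Fin 3 → A} (hT : S.IsSTT T) (f : A) :
    S.int (∑ a, ∑ b, T a b * V b * S.D a f) = - S.int (f * ∑ b, V b * S.div₂ T b) := by
  have hTV := hV.sum_mul_D_eq hT
  rw [eq_neg_iff_add_eq_zero, ← map_add, ← ((hT.isTangent_contract V).mul_left f).int_div₁]
  congr 1
  simp only [div₁_apply, div₂_apply, D_mul, Fin.sum_univ_three, map_add] at hTV ⊢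
  linear_combination -f * hTV

theorem int_sum_rot_mul_shearDensity {C : Fin 3 → Fin 3 → A} (hC : S.IsSTT C) (f : A)
    (k : Fin 3) : S.int (∑ a, S.rot k a * S.shearDensity C f a) = 0 := by
  have hrot : ∀ a, S.rot k a + ∑ b, S.eps b a * S.D b (S.x k) = 0 := fun a => by
    have h := S.sum_metric_mul_eps k a
    simp only [rot, D_x_eq_metric, S.metric_comm _ k, mul_comm (S.eps _ a)]
    rw [h, S.eps_comm a k, neg_add_cancel]
  rw [(S.isConformalKilling_rot k).int_sum_mul_shearDensity hC]
  simp only [hrot, zero_mul, mul_zero, Finset.sum_const_zero, add_zero, map_zero]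

theorem int_sum_grad_x_mul_shearDensity {C : Fin 3 → Fin 3 → A} (hC : S.IsSTT C) (f : A)
    (k : Fin 3) :
    S.int (∑ a, S.grad (S.x k) a * S.shearDensity C f a) =
      S.int (2 * f * ∑ a, S.grad (S.x k) a * S.div₂ C a
        - 2 * S.x k * ∑ a, S.div₂ C a * S.D a f - S.x k * (S.lap f + 2 * f) ^ 2) := by
  rw [(S.isConformalKilling_grad_x k).int_sum_mul_shearDensity hC]
  congr 1
  simp only [map_zero, mul_zero, Finset.sum_const_zero, add_zero]
  ring

theorem int_x_mul_sum_mul_hess {T : Fin 3 → Fin 3 → A} (hT : S.IsSTT T) (f : A) (k : Fin 3) :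
    S.int (S.x k * ∑ a, ∑ b, T a b * S.hess f a b) =
      S.int (f * ∑ a, S.grad (S.x k) a * S.div₂ T a - S.x k * ∑ a, S.div₂ T a * S.D a f) := by
  have hV := (S.isConformalKilling_grad_x k).int_sum_mul_mul_D hT f
  have hsymm : ∑ a, ∑ b, T a b * S.D a (S.x k) * S.D b f =
      ∑ a, ∑ b, T a b * S.grad (S.x k) b * S.D a f := by
    rw [Finset.sum_comm]
    simp only [hT.symm, grad_apply]
  rw [hT.int_mul_sum_mul_hess, map_add, hsymm, hV, map_sub]
  ring

theorem int_x_mul_sq_lap_add_two_mul (f : A) (k : Fin 3) :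
    S.int (S.x k * (S.lap f + 2 * f) ^ 2) =
      S.int (∑ a, (f * S.grad (S.x k) a - S.x k * S.grad f a) * S.D a (S.lap f + 2 * f)) := by
  have hw : S.IsTangent fun a => f * S.grad (S.x k) a - S.x k * S.grad f a := by
    have hf := (S.isTangent_grad f).mul_left (S.x k)
    have hx := (S.isTangent_grad (S.x k)).mul_left f
    rw [IsTangent] at *
    simp only [mul_sub, Finset.sum_sub_distrib, hf, hx, sub_zero]
  have hdiv := (S.isConformalKilling_grad_x k).div₁_eq
  rw [hw.int_sum_mul_D, ← map_neg]
  congr 1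
  simp only [div₁_apply, lap_apply, grad_apply, D_mul, Fin.sum_univ_three, map_sub] at hdiv ⊢
  linear_combination f * (S.D 0 (S.D 0 f) + S.D 1 (S.D 1 f) + S.D 2 (S.D 2 f) + 2 * f) * hdiv

/-- The pointwise inner product `S_{AB} T^{AB}`. -/
def inner₂ (T T' : Fin 3 → Fin 3 → A) : A := ∑ a, ∑ b, T a b * T' a b

theorem two_mul_int_sum_grad_x_mul_shearDensity {C : Fin 3 → Fin 3 → A} (hC : S.IsSTT C) (f : A)
    (k : Fin 3) :
    2 * S.int (∑ a, S.grad (S.x k) a * S.shearDensity C f a) =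
      S.int (S.x k * (inner₂ C C - inner₂ (C - S.hessTF f) (C - S.hessTF f))) := by
  have hC' := hC.sub (S.isSTT_hessTF f)
  have hT := hC.add hC'
  have hdiv : ∀ a, S.div₂ (C + (C - S.hessTF f)) a = 2 * S.div₂ C a - S.D a (S.lap f + 2 * f) :=
    fun a => by
      rw [map_add, map_sub, Pi.add_apply, Pi.sub_apply, div₂_hessTF]
      ring
  have hinner : inner₂ C C - inner₂ (C - S.hessTF f) (C - S.hessTF f) =
      2 * ∑ a, ∑ b, (C + (C - S.hessTF f)) a b * S.hess f a b := by
    rw [← hT.sum_mul_hessTF]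
    simp only [inner₂, Pi.add_apply, Pi.sub_apply, ← Finset.sum_sub_distrib]
    exact Finset.sum_congr rfl fun a _ => Finset.sum_congr rfl fun b _ => by ring
  rw [hinner, mul_left_comm, two_mul, two_mul, map_add, S.int_x_mul_sum_mul_hess hT,
    S.int_sum_grad_x_mul_shearDensity hC, map_sub _ _ (S.x k * _),
    S.int_x_mul_sq_lap_add_two_mul, ← map_sub]
  congr 2 <;> simp only [hdiv, grad_apply, Fin.sum_univ_three] <;> ring

/-! ### Potentials of a supertranslated shear -/

theorem int_x (a : Fin 3) : S.int (S.x a) = 0 := by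
  have h := S.int_D a 1
  rw [Derivation.map_one_eq_zero, map_zero, mul_one] at h
  linarith

theorem int_x_mul_x (a b : Fin 3) :
    S.int (S.x a * S.x b) = if a = b then 4 * Real.pi / 3 else 0 := by
  have h := S.int_D a (S.x b)
  rw [D_x, map_sub, apply_ite S.int, S.int_one, map_zero] at h
  split_ifs at h ⊢ <;> linarith

/-- The projection of a function to the modes `ℓ ≤ 1`. -/
def lowModes : A →ₗ[ℝ] A where
  toFun f := ((4 * Real.pi)⁻¹ * S.int f) • (1 : A)
    + ∑ i, (3 / (4 * Real.pi) * S.int (f * S.x i)) • S.x i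
  map_add' f g := by
    simp only [add_mul, map_add, mul_add, add_smul, Finset.sum_add_distrib]
    abel
  map_smul' r f := by
    simp only [smul_mul_assoc, map_smul, smul_eq_mul, mul_left_comm _ r, mul_smul, smul_add,
      Finset.smul_sum, RingHom.id_apply]

theorem lowModes_apply (f : A) :
    S.lowModes f = ((4 * Real.pi)⁻¹ * S.int f) • (1 : A)
      + ∑ i, (3 / (4 * Real.pi) * S.int (f * S.x i)) • S.x i := rfl

theorem sub_lowModes_mem_highModes (f : A) : f - S.lowModes f ∈ S.highModes := by
  have hpi := Real.pi_ne_zero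
  refine S.mem_highModes.2 ⟨?_, fun i => ?_⟩
  · simp only [lowModes_apply, map_sub, map_add, map_sum, map_smul, int_x, S.int_one, smul_eq_mul,
      mul_zero, Finset.sum_const_zero]
    field_simp
    ring
  · simp only [lowModes_apply, sub_mul, add_mul, Finset.sum_mul, smul_mul_assoc, one_mul, map_sub,
      map_add, map_sum, map_smul, int_x, int_x_mul_x, smul_eq_mul, mul_zero, mul_ite,
      Finset.sum_ite_eq', Finset.mem_univ, if_true]
    field_simp
    ring

theorem hessTF_one : S.hessTF 1 = 0 := by
  ext a b
  simp [hessTF_apply, hess_apply, lap_apply]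

theorem hessTF_x (k : Fin 3) : S.hessTF (S.x k) = 0 := by
  refine S.hessTF_eq_zero ?_
  rw [show S.lap (S.x k) = 2 * -S.x k from (S.isConformalKilling_grad_x k).div₁_eq]
  ring

theorem hessTF_lowModes (f : A) : S.hessTF (S.lowModes f) = 0 := by
  simp only [lowModes_apply, map_add, map_sum, map_smul, hessTF_one, hessTF_x, smul_zero,
    Finset.sum_const_zero, add_zero]

/-- The potentials of a shear: `c` of its closed part and `cb` of its co-closed part, normalized to
have no modes `ℓ ≤ 1`. -/
structure IsPotentials (C : Fin 3 → Fin 3 → A) (c cb : A) : Prop where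
  closed_mem : c ∈ S.highModes
  coclosed_mem : cb ∈ S.highModes
  two_smul_eq : (2 : ℝ) • C = S.hessTF c + S.rotHess cb

theorem IsPotentials.eq_of_sub_hessTF {S : TangentialCalculus A} {C : Fin 3 → Fin 3 → A}
    {f c cb c' cb' : A} (h : S.IsPotentials C c cb) (h' : S.IsPotentials (C - S.hessTF f) c' cb') :
    c' = c - (2 : ℝ) • (f - S.lowModes f) ∧ cb' = cb := by
  have hshear : S.hessTF (c' - (c - (2 : ℝ) • (f - S.lowModes f))) + S.rotHess (cb' - cb) = 0 := by
    have hC := h.two_smul_eq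
    have hC' := h'.two_smul_eq
    simp only [map_sub, map_smul, hessTF_lowModes, sub_zero, smul_sub, smul_zero] at hC' ⊢
    rw [hC] at hC'
    linear_combination -hC'
  have hmem : c - (2 : ℝ) • (f - S.lowModes f) ∈ S.highModes :=
    sub_mem h.closed_mem (S.highModes.smul_mem 2 (S.sub_lowModes_mem_highModes f))
  obtain ⟨hc, hcb⟩ := S.eq_zero_of_hessTF_add_rotHess hshear (sub_mem h'.closed_mem hmem)
    (sub_mem h'.coclosed_mem h.coclosed_mem)
  exact ⟨sub_eq_zero.1 hc, sub_eq_zero.1 hcb⟩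

end TangentialCalculus

/-! ### The effect of a supertranslation on the conserved quantities -/

/-- The null infinity fields at one retarded time: mass aspect, angular momentum aspect, shear. -/
structure Slice (A : Type*) where
  m : A
  N : Fin 3 → A
  C : Fin 3 → Fin 3 → A

namespace TangentialCalculus

variable {A : Type*} [CommRing A] [Algebra ℝ A] (S : TangentialCalculus A)

/-- The `L²` inner product with the vector field `V`. -/
def pair (V : Fin 3 → A) : (Fin 3 → A) →ₗ[ℝ] ℝ :=
  S.int ∘ₗ ∑ a, LinearMap.mulLeft ℝ (V a) ∘ₗ LinearMap.proj a

theorem pair_apply (V w : Fin 3 → A) : S.pair V w = S.int (∑ a, V a * w a) := by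
  simp [pair]

theorem pair_rot_grad (k : Fin 3) (f : A) : S.pair (S.rot k) (S.grad f) = 0 := by
  have h := (S.isConformalKilling_rot k).int_sum_mul_D f
  rwa [zero_mul, map_zero, mul_zero, ← pair_apply] at h

theorem pair_grad_x_grad (k : Fin 3) (f : A) :
    S.pair (S.grad (S.x k)) (S.grad f) = 2 * S.int (S.x k * f) := by
  have h := (S.isConformalKilling_grad_x k).int_sum_mul_D f
  rwa [neg_mul (S.x k), map_neg, neg_mul_neg, ← pair_apply] at h

/-- The slice of stationary fields at displaced retarded time `u + τ`, in the Bondi-Sachs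
coordinates supertranslated by `τ`. Besides the transformation law this contains the evolution
equation `∂_u N_A = ∇_A m - ¼ ∇^B P_{BA}` for vanishing news. -/
def supertranslate (F : Slice A) (τ : A) : Slice A where
  m := F.m
  N := F.N + τ • S.grad F.m + (3 : ℝ) • (F.m • S.grad τ)
    - (1 / 4 : ℝ) • fun a => τ * S.div₂ (S.curl (S.div₂ F.C)) a
      + 3 * ∑ b, S.curl (S.div₂ F.C) b a * S.D b τ
  C := F.C - S.hessTF τ

/-- The one-form `N_A - ¼ C_{AB} ∇_D C^{DB} - c ∇_A m`. -/
def flux (F : Slice A) (c : A) : Fin 3 → A :=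
  F.N - (1 / 4 : ℝ) • S.quad F.C - c • S.grad F.m

/-- The CWY angular momentum of a slice. -/
def angularMomentum (F : Slice A) (c : A) (k : Fin 3) : ℝ := S.pair (S.rot k) (S.flux F c)

/-- The CWY center of mass of a slice at retarded time `u`. -/
def centerOfMass (F : Slice A) (u : ℝ) (c cb : A) (k : Fin 3) : ℝ :=
  S.pair (S.grad (S.x k)) (S.flux F c - u • S.grad F.m
    - (1 / 16 : ℝ) • S.grad (inner₂ F.C F.C) + (2 : ℝ) • (F.m • S.rotGrad cb))
  + S.int ((3 : ℝ) • (S.x k * c * F.m) - (1 / 16 : ℝ) • (S.x k *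
      ∑ b, S.div₂ (S.rotHess cb) b * S.div₂ (S.rotHess cb) b))

theorem flux_supertranslate (F : Slice A) (τ l c : A) :
    S.flux (S.supertranslate F τ) (c - (2 : ℝ) • (τ - l)) = S.flux F c
      + (3 : ℝ) • S.grad (F.m * τ) - (2 : ℝ) • (l • S.grad F.m)
      - (1 / 4 : ℝ) • S.shearDensity F.C τ := by
  ext a
  simp only [flux, supertranslate, shearDensity, Pi.add_apply, Pi.sub_apply, Pi.smul_apply,
    grad_apply, D_mul, smul_eq_mul]
  simp only [Algebra.smul_def, map_ofNat]
  ring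

theorem angularMomentum_supertranslate {F : Slice A} (hC : S.IsSTT F.C) (τ l c : A) (k : Fin 3) :
    S.angularMomentum (S.supertranslate F τ) (c - (2 : ℝ) • (τ - l)) k =
      S.angularMomentum F c k - 2 * S.pair (S.rot k) (l • S.grad F.m) := by
  have hsD : S.pair (S.rot k) (S.shearDensity F.C τ) = 0 := by
    rw [pair_apply, S.int_sum_rot_mul_shearDensity hC]
  simp only [angularMomentum, flux_supertranslate, map_sub, map_add, map_smul, pair_rot_grad, hsD,
    smul_eq_mul, mul_zero, add_zero, sub_zero]

theorem centerOfMass_supertranslate {F : Slice A} (hC : S.IsSTT F.C) (u : ℝ) (τ l c cb : A)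
    (k : Fin 3) :
    S.centerOfMass (S.supertranslate F τ) u (c - (2 : ℝ) • (τ - l)) cb k =
      S.centerOfMass F u c cb k + 6 * S.int (l * S.x k * F.m)
        - 2 * S.pair (S.grad (S.x k)) (l • S.grad F.m) := by
  have hsD := S.two_mul_int_sum_grad_x_mul_shearDensity hC τ k
  have hτ : S.x k * (F.m * τ) = l * S.x k * F.m + (τ - l) * S.x k * F.m := by ring
  have hc : S.x k * (c - (2 : ℝ) • (τ - l)) * F.m =
      S.x k * c * F.m - (2 : ℝ) • ((τ - l) * S.x k * F.m) := by
    simp only [Algebra.smul_def]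
    ring
  rw [← pair_apply, mul_sub, map_sub] at hsD
  rw [centerOfMass, flux_supertranslate]
  simp only [supertranslate]
  rw [hc]
  simp only [centerOfMass, map_add, map_sub, map_smul, pair_grad_x_grad, hτ, smul_eq_mul]
  linarith

theorem centerOfMass_add (F : Slice A) (u s : ℝ) (c cb : A) (k : Fin 3) :
    S.centerOfMass F (u + s) c cb k =
      S.centerOfMass F u c cb k - 2 * s * S.int (S.x k * F.m) := by
  simp only [centerOfMass, add_smul, map_add, map_sub, map_smul, pair_grad_x_grad, smul_eq_mul]
  ring

variable {S} in
theorem IsPotentials.eq_of_supertranslate {F : Slice A} {f c cb c' cb' : A} {s : ℝ}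
    (h : S.IsPotentials F.C c cb)
    (h' : S.IsPotentials (S.supertranslate F (s • 1 + f)).C c' cb') :
    c' = c - (2 : ℝ) • ((s • 1 + f) - (s • 1 + S.lowModes f)) ∧ cb' = cb := by
  have hshear : (S.supertranslate F (s • 1 + f)).C = F.C - S.hessTF f := by
    simp only [supertranslate, map_add, map_smul, hessTF_one, smul_zero, zero_add]
  rw [add_sub_add_left_eq_sub]
  exact h.eq_of_sub_hessTF (hshear ▸ h')

variable {S} in
theorem IsPotentials.angularMomentum_supertranslate_sub {F : Slice A} {f c cb c' cb' : A} {s : ℝ}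
    (h : S.IsPotentials F.C c cb)
    (h' : S.IsPotentials (S.supertranslate F (s • 1 + f)).C c' cb')
    (hC : S.IsSTT F.C) (k : Fin 3) :
    S.angularMomentum (S.supertranslate F (s • 1 + f)) c' k - S.angularMomentum F c k =
      -2 * S.pair (S.rot k) (S.lowModes f • S.grad F.m) := by
  rw [(h.eq_of_supertranslate h').1, S.angularMomentum_supertranslate hC, add_smul, map_add,
    smul_assoc, one_smul, map_smul, pair_rot_grad, smul_zero, zero_add]
  ring

variable {S} in
theorem IsPotentials.centerOfMass_supertranslate_sub {F : Slice A} {f c cb c' cb' : A} {s : ℝ}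
    (h : S.IsPotentials F.C c cb)
    (h' : S.IsPotentials (S.supertranslate F (s • 1 + f)).C c' cb')
    (hC : S.IsSTT F.C) (u : ℝ) (k : Fin 3) :
    S.centerOfMass (S.supertranslate F (s • 1 + f)) (u + s) c' cb' k
        - S.centerOfMass F u c cb k =
      6 * S.int (S.lowModes f * S.x k * F.m)
        - 2 * S.pair (S.grad (S.x k)) (S.lowModes f • S.grad F.m) := by
  rw [(h.eq_of_supertranslate h').1, (h.eq_of_supertranslate h').2,
    S.centerOfMass_supertranslate hC, centerOfMass_add]
  simp only [add_mul, add_smul, smul_assoc, one_smul, smul_mul_assoc, one_mul, map_add, map_smul,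
    pair_grad_x_grad, smul_eq_mul]
  ring

end TangentialCalculus

local notation "E3" => EuclideanSpace ℝ (Fin 3)

/-! ### Smooth functions on the sphere and their radial extensions -/

instance : IsFiniteMeasure area := inferInstanceAs (IsFiniteMeasure volume.toSphere)

instance : area.IsOpenPosMeasure := inferInstanceAs volume.toSphere.IsOpenPosMeasure

theorem S2.ne_zero (x : S2) : (x : E3) ≠ 0 :=
  norm_ne_zero_iff.1 (by simp)

theorem S2.norm_eq_one (x : S2) : ‖(x : E3)‖ = 1 := by simp

theorem radialExt_apply (f : S2 → ℝ) {y : E3} (hy : y ≠ 0) :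
    radialExt f y = f ⟨‖y‖⁻¹ • y, normalize_mem hy⟩ := dif_pos hy

theorem radialExt_coe (f : S2 → ℝ) (x : S2) : radialExt f x = f x := by
  rw [radialExt_apply f x.ne_zero]
  congr 1
  ext1
  simp [x.norm_eq_one]

theorem radialExt_smul (f : S2 → ℝ) {r : ℝ} (hr : 0 < r) (y : E3) :
    radialExt f (r • y) = radialExt f y := by
  by_cases hy : y = 0
  · rw [hy, smul_zero]
  · rw [radialExt_apply f hy, radialExt_apply f (smul_ne_zero hr.ne' hy)]
    congr 2
    rw [norm_smul, Real.norm_of_nonneg hr.le, smul_smul, mul_inv_rev, inv_mul_cancel_right₀ hr.ne']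

theorem radialExt_add (f g : S2 → ℝ) : radialExt (f + g) = radialExt f + radialExt g := by
  ext y
  by_cases hy : y = 0 <;> simp [radialExt, hy]

theorem radialExt_const_smul (r : ℝ) (f : S2 → ℝ) : radialExt (r • f) = r • radialExt f := by
  ext y
  by_cases hy : y = 0 <;> simp [radialExt, hy]

theorem radialExt_mul (f g : S2 → ℝ) : radialExt (f * g) = radialExt f * radialExt g := by
  ext y
  by_cases hy : y = 0 <;> simp [radialExt, hy]

theorem radialExt_coord (k : Fin 3) (y : E3) : radialExt (coord k) y = ‖y‖⁻¹ * y k := by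
  by_cases hy : y = 0 <;> simp [radialExt, hy, coord]

theorem fderiv_radialExt_smul (f : S2 → ℝ) {r : ℝ} (hr : 0 < r) (y v : E3) :
    fderiv ℝ (radialExt f) (r • y) v = r⁻¹ * fderiv ℝ (radialExt f) y v := by
  have h := fderiv_comp_smul (𝕜 := ℝ) (f := radialExt f) (x := y) r
  simp only [radialExt_smul f hr] at h
  rw [show fderiv ℝ (radialExt f) y = _ from h, smul_apply, smul_eq_mul,
    inv_mul_cancel_left₀ hr.ne']

theorem radialExt_grad (f : S2 → ℝ) (a : Fin 3) {y : E3} (hy : y ≠ 0) :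
    radialExt (fun x => grad f x a) y =
      ‖y‖ * fderiv ℝ (radialExt f) y (EuclideanSpace.single a 1) := by
  rw [radialExt_apply _ hy, grad,
    fderiv_radialExt_smul f (inv_pos.2 (norm_pos_iff.2 hy)), inv_inv]

namespace SmoothFn

variable {f g : S2 → ℝ}

theorem continuous (hf : SmoothFn f) : Continuous f := ContMDiff.continuous hf

theorem integrable (hf : SmoothFn f) : Integrable f area :=
  hf.continuous.integrable_of_hasCompactSupport (HasCompactSupport.of_compactSpace f)

theorem contDiffAt_radialExt (hf : SmoothFn f) {y : E3} (hy : y ≠ 0) :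
    ContDiffAt ℝ ∞ (radialExt f) y := by
  have : Fact (Module.finrank ℝ E3 = 2 + 1) := ⟨finrank_euclideanSpace_fin⟩
  let U : TopologicalSpace.Opens E3 := ⟨{0}ᶜ, isOpen_compl_singleton⟩
  have hnormalize : ContMDiff 𝓘(ℝ, E3) 𝓘(ℝ, E3) ∞ (fun z : U => ‖(z : E3)‖⁻¹ • (z : E3)) := by
    intro z
    refine (contMDiffAt_subtype_iff (f := fun w : E3 => ‖w‖⁻¹ • w)).2 ?_
    exact (((contDiffAt_norm ℝ z.2).inv (norm_ne_zero_iff.2 z.2)).smul contDiffAt_id).contMDiffAt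
  have hcomp := hf.comp (ContMDiff.codRestrict_sphere (n := 2) hnormalize fun z =>
    normalize_mem z.2)
  rw [← contMDiffAt_iff_contDiffAt]
  refine (contMDiffAt_subtype_iff (U := U) (x := ⟨y, hy⟩)).1 ?_
  exact (hcomp ⟨y, hy⟩).congr_of_eventuallyEq (.of_forall fun z => radialExt_apply f z.2)

theorem differentiableAt_radialExt (hf : SmoothFn f) {y : E3} (hy : y ≠ 0) :
    DifferentiableAt ℝ (radialExt f) y :=
  (hf.contDiffAt_radialExt hy).differentiableAt (by simp)

theorem contDiffAt_fderiv_radialExt (hf : SmoothFn f) {y : E3} (hy : y ≠ 0) :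
    ContDiffAt ℝ ∞ (fderiv ℝ (radialExt f)) y :=
  (hf.contDiffAt_radialExt hy).fderiv_right (m := ∞) (by simp)

theorem of_contDiffAt {F : E3 → ℝ} (hF : ∀ x : S2, ContDiffAt ℝ ∞ F x) :
    SmoothFn (fun x : S2 => F x) := fun x =>
  haveI : Fact (Module.finrank ℝ E3 = 2 + 1) := ⟨finrank_euclideanSpace_fin⟩
  (hF x).contMDiffAt.comp x (contMDiff_coe_sphere (n := 2) x)

protected theorem grad (hf : SmoothFn f) (a : Fin 3) : SmoothFn (fun x => grad f x a) :=
  of_contDiffAt fun x =>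
    (hf.contDiffAt_fderiv_radialExt x.ne_zero).clm_apply contDiffAt_const

theorem grad_add (hf : SmoothFn f) (hg : SmoothFn g) (x : S2) (a : Fin 3) :
    grad (f + g) x a = grad f x a + grad g x a := by
  rw [grad, radialExt_add, fderiv_add (hf.differentiableAt_radialExt x.ne_zero)
    (hg.differentiableAt_radialExt x.ne_zero)]
  rfl

theorem grad_const_smul (hf : SmoothFn f) (r : ℝ) (x : S2) (a : Fin 3) :
    grad (r • f) x a = r * grad f x a := by
  rw [grad, radialExt_const_smul, fderiv_const_smul (hf.differentiableAt_radialExt x.ne_zero)]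
  rfl

theorem grad_mul (hf : SmoothFn f) (hg : SmoothFn g) (x : S2) (a : Fin 3) :
    grad (f * g) x a = f x * grad g x a + g x * grad f x a := by
  rw [grad, radialExt_mul, fderiv_mul (hf.differentiableAt_radialExt x.ne_zero)
    (hg.differentiableAt_radialExt x.ne_zero), radialExt_coe, radialExt_coe]
  rfl

theorem fderiv_radialExt_self (hf : SmoothFn f) (x : S2) :
    fderiv ℝ (radialExt f) x (x : E3) = 0 := by
  have hray : HasDerivAt (fun t : ℝ => t • (x : E3)) (x : E3) 1 := by
    simpa using (hasDerivAt_id (1 : ℝ)).smul_const (x : E3)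
  have hext : HasFDerivAt (radialExt f) (fderiv ℝ (radialExt f) x) ((1 : ℝ) • (x : E3)) := by
    rw [one_smul]
    exact (hf.differentiableAt_radialExt x.ne_zero).hasFDerivAt
  have hconst : HasDerivAt (radialExt f ∘ fun t : ℝ => t • (x : E3)) 0 1 := by
    refine (hasDerivAt_const (1 : ℝ) (radialExt f x)).congr_of_eventuallyEq ?_
    filter_upwards [lt_mem_nhds (zero_lt_one (α := ℝ))] with t ht using radialExt_smul f ht _
  exact (hext.comp_hasDerivAt (1 : ℝ) hray).unique hconst

end SmoothFn

theorem smoothFn_coord (k : Fin 3) : SmoothFn (coord k) :=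
  SmoothFn.of_contDiffAt (F := fun y : E3 => y k) fun x => by fun_prop

theorem clm_apply_eq_sum (L : E3 →L[ℝ] ℝ) (v : E3) :
    L v = ∑ a, v a * L (EuclideanSpace.single a 1) := by
  conv_lhs => rw [← (EuclideanSpace.basisFun (Fin 3) ℝ).sum_repr v]
  simp

theorem SmoothFn.sum_coord_mul_grad {f : S2 → ℝ} (hf : SmoothFn f) (x : S2) :
    ∑ a, coord a x * grad f x a = 0 :=
  (clm_apply_eq_sum _ _).symm.trans (hf.fderiv_radialExt_self x)

theorem S2.hasFDerivAt_norm (x : S2) : HasFDerivAt (fun y : E3 => ‖y‖) (innerSL ℝ (x : E3)) x := by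
  have h := (hasStrictFDerivAt_norm_sq (x : E3)).hasFDerivAt.sqrt (by simp [x.norm_eq_one])
  simp only [Real.sqrt_sq (norm_nonneg _), x.norm_eq_one] at h
  convert! h using 1
  ext v
  simp

theorem grad_coord (k : Fin 3) (x : S2) (a : Fin 3) :
    grad (coord k) x a = (if a = k then 1 else 0) - coord a x * coord k x := by
  have h : HasFDerivAt (fun y : E3 => ‖y‖⁻¹ * y k)
      (‖(x : E3)‖⁻¹ • (EuclideanSpace.proj k : E3 →L[ℝ] ℝ) +
        (x : E3) k • (-(‖(x : E3)‖ ^ 2)⁻¹) • innerSL ℝ (x : E3)) x :=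
    ((hasDerivAt_inv (by simp [x.norm_eq_one])).comp_hasFDerivAt (x : E3)
      x.hasFDerivAt_norm).mul (EuclideanSpace.proj k : E3 →L[ℝ] ℝ).hasFDerivAt
  rw [grad, funext (radialExt_coord k), h.fderiv]
  simp [x.norm_eq_one, coord, EuclideanSpace.inner_single_right, eq_comm]
  ring

theorem SmoothFn.grad_grad {f : S2 → ℝ} (hf : SmoothFn f) (x : S2) (a b : Fin 3) :
    grad (fun x => grad f x b) x a =
      coord a x * grad f x b + fderiv ℝ (fderiv ℝ (radialExt f)) x
        (EuclideanSpace.single a 1) (EuclideanSpace.single b 1) := by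
  have heq : radialExt (fun x => grad f x b) =ᶠ[nhds (x : E3)]
      fun y : E3 => ‖y‖ * fderiv ℝ (radialExt f) y (EuclideanSpace.single b 1) := by
    filter_upwards [isOpen_ne.mem_nhds x.ne_zero] with y hy using radialExt_grad f b hy
  have hdiff : DifferentiableAt ℝ (fderiv ℝ (radialExt f)) x :=
    (hf.contDiffAt_fderiv_radialExt x.ne_zero).differentiableAt (by simp)
  have hmul := x.hasFDerivAt_norm.mul
    (hdiff.hasFDerivAt.clm_apply (hasFDerivAt_const (EuclideanSpace.single b (1 : ℝ)) (x : E3)))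
  conv_lhs => rw [grad, heq.fderiv_eq]
  refine (congrArg (fun L => L (EuclideanSpace.single a 1)) hmul.fderiv).trans ?_
  simp [x.norm_eq_one, coord, grad, EuclideanSpace.inner_single_right]
  ring

theorem SmoothFn.grad_grad_comm {f : S2 → ℝ} (hf : SmoothFn f) (x : S2) (a b : Fin 3) :
    grad (fun x => grad f x b) x a =
      grad (fun x => grad f x a) x b +
        coord a x * grad f x b - coord b x * grad f x a := by
  have h := (hf.contDiffAt_radialExt x.ne_zero).isSymmSndFDerivAt (by
    rw [minSmoothness_of_isRCLikeNormedField]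
    exact WithTop.coe_le_coe.2 (le_top : (2 : ℕ∞) ≤ ⊤))
  rw [hf.grad_grad, hf.grad_grad, h.eq]
  ring

theorem SmoothFn.exists_eq_const {f : S2 → ℝ} (hf : SmoothFn f)
    (h : ∀ x a, grad f x a = 0) : ∃ r, ∀ x, f x = r := by
  have hrank : 1 < Module.rank ℝ E3 := by
    rw [← Module.finrank_eq_rank, finrank_euclideanSpace_fin]
    norm_num
  have hfderiv : Set.EqOn (fderiv ℝ (radialExt f)) 0 {0}ᶜ := by
    intro y hy
    ext v
    have hsingle (a : Fin 3) : fderiv ℝ (radialExt f) y (EuclideanSpace.single a 1) = 0 := by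
      have hy' := radialExt_grad f a hy
      rw [radialExt_apply _ hy, h] at hy'
      exact (mul_eq_zero.1 hy'.symm).resolve_left (norm_ne_zero_iff.2 hy)
    simp [clm_apply_eq_sum _ v, hsingle]
  obtain ⟨r, hr⟩ := isOpen_compl_singleton.exists_is_const_of_fderiv_eq_zero
    (isConnected_compl_singleton_of_one_lt_rank hrank 0).isPreconnected
    (fun y hy => (hf.differentiableAt_radialExt hy).differentiableWithinAt) hfderiv
  exact ⟨r, fun x => by rw [← hr x x.ne_zero, radialExt_coe]⟩

/-! ### Integration over the sphere -/

theorem integral_norm_mul_radialExt (h : ℝ → ℝ) (g : S2 → ℝ) :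
    ∫ y : E3, h ‖y‖ * radialExt g y =
      (∫ r in Set.Ioi (0 : ℝ), r ^ 2 * h r) * ∫ x, g x ∂area := by
  have hradial : ∫ r : Set.Ioi (0 : ℝ), h r ∂.volumeIoiPow 2 =
      ∫ r in Set.Ioi (0 : ℝ), r ^ 2 * h r := by
    simp only [Measure.volumeIoiPow, ENNReal.ofReal]
    rw [integral_withDensity_eq_integral_smul (measurable_subtype_coe.pow_const _).real_toNNReal,
      integral_subtype_comap measurableSet_Ioi fun a => Real.toNNReal (a ^ 2) • h a]
    simp only [NNReal.smul_def, Real.coe_toNNReal _ (sq_nonneg _), smul_eq_mul]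
  calc
    ∫ y : E3, h ‖y‖ * radialExt g y
      = ∫ y : ({0}ᶜ : Set E3), h ‖y.1‖ * radialExt g y ∂(volume : Measure E3).comap (↑) := by
      rw [integral_subtype_comap (measurableSet_singleton _).compl
        fun y => h ‖y‖ * radialExt g y, restrict_compl_singleton]
    _ = ∫ p, g p.1 * h p.2 ∂area.prod (.volumeIoiPow 2) := by
      have hpolar := Measure.measurePreserving_homeomorphUnitSphereProd (volume : Measure E3)
      rw [finrank_euclideanSpace_fin] at hpolar
      rw [area, ← hpolar.integral_comp (Homeomorph.measurableEmbedding _)]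
      refine integral_congr_ae (.of_forall fun y => ?_)
      simp only [homeomorphUnitSphereProd_apply_snd_coe]
      rw [radialExt_apply g y.2, mul_comm]
      congr 2
      exact Subtype.ext (homeomorphUnitSphereProd_apply_fst_coe _ _).symm
    _ = (∫ r in Set.Ioi (0 : ℝ), r ^ 2 * h r) * ∫ x, g x ∂area := by
      rw [integral_prod_mul g fun r : Set.Ioi (0 : ℝ) => h r, hradial, mul_comm]

/-- A bump function in `t = |y|²`. The weight `|y|² ↦ annulusBump (|y|²)` on `ℝ³` is smooth with
compact support away from the origin, where radial extensions are singular. -/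
def annulusBump : ContDiffBump (2 : ℝ) := ⟨1 / 2, 1, by norm_num, by norm_num⟩

theorem tsupport_annulusBump_norm_sq_subset :
    tsupport (fun y : E3 => annulusBump (‖y‖ ^ 2)) ⊆
      (fun y : E3 => ‖y‖ ^ 2) ⁻¹' Metric.closedBall 2 1 := by
  have h := tsupport_comp_subset_preimage (f := fun y : E3 => ‖y‖ ^ 2) annulusBump (by fun_prop)
  rwa [annulusBump.tsupport_eq] at h

theorem zero_notMem_tsupport_annulusBump_norm_sq :
    (0 : E3) ∉ tsupport fun y : E3 => annulusBump (‖y‖ ^ 2) := fun h => by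
  simpa [Real.dist_eq] using tsupport_annulusBump_norm_sq_subset h

theorem hasCompactSupport_annulusBump_norm_sq :
    HasCompactSupport fun y : E3 => annulusBump (‖y‖ ^ 2) := by
  refine (isCompact_closedBall (0 : E3) 2).of_isClosed_subset (isClosed_tsupport _) fun y hy => ?_
  have hy' : |‖y‖ ^ 2 - 2| ≤ 1 := tsupport_annulusBump_norm_sq_subset hy
  rw [mem_closedBall_zero_iff]
  nlinarith [norm_nonneg y, (abs_le.1 hy').2]

theorem contDiff_annulusBump_norm_sq : ContDiff ℝ ∞ fun y : E3 => annulusBump (‖y‖ ^ 2) :=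
  annulusBump.contDiff.comp (contDiff_norm_sq ℝ)

theorem fderiv_annulusBump_norm_sq (y : E3) (a : Fin 3) :
    fderiv ℝ (fun y : E3 => annulusBump (‖y‖ ^ 2)) y (EuclideanSpace.single a 1) =
      deriv annulusBump (‖y‖ ^ 2) * (2 * y a) := by
  have hbump : HasDerivAt annulusBump (deriv annulusBump (‖y‖ ^ 2)) (‖y‖ ^ 2) :=
    ((annulusBump.contDiff (n := 1)).differentiable (by simp) _).hasDerivAt
  have h := hbump.comp_hasFDerivAt y (hasStrictFDerivAt_norm_sq y).hasFDerivAt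
  refine (congrArg (fun L => L (EuclideanSpace.single a 1)) h.fderiv).trans ?_
  simp [EuclideanSpace.inner_single_right]

theorem integrable_mul_of_zero_notMem_tsupport {g F : E3 → ℝ} (hg : Continuous g)
    (hc : HasCompactSupport g) (h0 : (0 : E3) ∉ tsupport g) (hF : ContinuousOn F {0}ᶜ) :
    Integrable (fun y => g y * F y) := by
  refine Continuous.integrable_of_hasCompactSupport ?_ hc.mul_right
  refine (hg.continuousOn.mul hF).continuous_of_tsupport_subset isOpen_compl_singleton ?_
  rintro y hy rfl
  exact h0 (tsupport_mul_subset_left hy)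

theorem SmoothFn.integral_annulusBump_mul_fderiv {f : S2 → ℝ} (hf : SmoothFn f) (v : E3) :
    ∫ y, annulusBump (‖y‖ ^ 2) * fderiv ℝ (radialExt f) y v =
      -∫ y, fderiv ℝ (fun y : E3 => annulusBump (‖y‖ ^ 2)) y v * radialExt f y := by
  have hsmooth := contDiff_annulusBump_norm_sq
  have hsupp := hasCompactSupport_annulusBump_norm_sq
  have hzero := zero_notMem_tsupport_annulusBump_norm_sq
  have hcont : ContinuousOn (radialExt f) {0}ᶜ := fun y hy =>
    (hf.contDiffAt_radialExt hy).continuousAt.continuousWithinAt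
  have hcont' : ContinuousOn (fun y => fderiv ℝ (radialExt f) y v) {0}ᶜ := fun y hy =>
    ((hf.contDiffAt_fderiv_radialExt hy).continuousAt.clm_apply
      continuousAt_const).continuousWithinAt
  exact integral_mul_fderiv_eq_neg_fderiv_mul_of_integrable
    (integrable_mul_of_zero_notMem_tsupport
      ((hsmooth.continuous_fderiv (by simp)).clm_apply continuous_const)
      (hsupp.fderiv_apply ℝ v) (fun h => hzero (tsupport_fderiv_apply_subset ℝ v h)) hcont)
    (integrable_mul_of_zero_notMem_tsupport hsmooth.continuous hsupp hzero hcont')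
    (integrable_mul_of_zero_notMem_tsupport hsmooth.continuous hsupp hzero hcont)
    (fun y _ => hsmooth.differentiable (by simp) y)
    (fun y hy => hf.differentiableAt_radialExt fun h => hzero (h ▸ hy))

theorem integral_annulusBump_sq_pos :
    0 < ∫ r in Set.Ioi (0 : ℝ), r ^ 2 * (annulusBump (r ^ 2) * r⁻¹) := by
  have hsubst : 2 * ∫ r in Set.Ioi (0 : ℝ), r ^ 2 * (annulusBump (r ^ 2) * r⁻¹) =
      ∫ t in Set.Ioi (0 : ℝ), annulusBump t := by
    rw [← integral_comp_rpow_Ioi_of_pos (g := fun t => annulusBump t) two_pos,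
      ← integral_const_mul]
    refine setIntegral_congr_fun measurableSet_Ioi fun r (hr : 0 < r) => ?_
    norm_num
    field_simp
  have hsupport : ∫ t in Set.Ioi (0 : ℝ), annulusBump t = ∫ t, annulusBump t := by
    refine setIntegral_eq_integral_of_forall_compl_eq_zero fun t ht => ?_
    refine annulusBump.zero_of_le_dist ?_
    rw [Set.mem_Ioi, not_lt] at ht
    change 1 ≤ |t - 2|
    rw [abs_of_nonpos (by linarith)]
    linarith
  have hpos := annulusBump.integral_pos (μ := volume)
  linarith

theorem exists_integral_grad_eq_mul : ∃ K : ℝ, ∀ f : S2 → ℝ, SmoothFn f → ∀ a,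
    ∫ x, grad f x a ∂area = K * ∫ x, coord a x * f x ∂area := by
  set K₁ := ∫ r in Set.Ioi (0 : ℝ), r ^ 2 * (annulusBump (r ^ 2) * r⁻¹)
  set K₂ := ∫ r in Set.Ioi (0 : ℝ), r ^ 2 * (deriv annulusBump (r ^ 2) * (2 * r))
  refine ⟨-K₂ / K₁, fun f hf a => ?_⟩
  have hgrad : ∫ y, annulusBump (‖y‖ ^ 2) * fderiv ℝ (radialExt f) y (EuclideanSpace.single a 1) =
      K₁ * ∫ x, grad f x a ∂area := by
    rw [← integral_norm_mul_radialExt (fun r => annulusBump (r ^ 2) * r⁻¹)]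
    refine integral_congr_ae ?_
    filter_upwards [Measure.ae_ne volume (0 : E3)] with y hy
    rw [radialExt_grad f a hy, mul_assoc, inv_mul_cancel_left₀ (norm_ne_zero_iff.2 hy)]
  have hcoord : ∫ y, fderiv ℝ (fun y : E3 => annulusBump (‖y‖ ^ 2)) y (EuclideanSpace.single a 1)
      * radialExt f y = K₂ * ∫ x, coord a x * f x ∂area := by
    rw [← integral_norm_mul_radialExt (fun r => deriv annulusBump (r ^ 2) * (2 * r))]
    refine integral_congr_ae ?_
    filter_upwards [Measure.ae_ne volume (0 : E3)] with y hy
    have hext : radialExt (fun x => coord a x * f x) y = ‖y‖⁻¹ * y a * radialExt f y :=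
      (congrFun (radialExt_mul (coord a) f) y).trans (congrArg (· * _) (radialExt_coord a y))
    have hy0 := norm_ne_zero_iff.2 hy
    rw [fderiv_annulusBump_norm_sq, hext]
    field_simp
  have hparts := hf.integral_annulusBump_mul_fderiv (EuclideanSpace.single a 1)
  rw [hgrad, hcoord] at hparts
  have hK₁ : K₁ ≠ 0 := integral_annulusBump_sq_pos.ne'
  field_simp
  linarith

theorem S2.sum_coord_mul_coord (x : S2) : ∑ a, coord a x * coord a x = 1 := by
  have h := EuclideanSpace.norm_sq_eq (x : E3)
  simpa [x.norm_eq_one, coord, sq] using h.symm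

theorem integral_one_area : ∫ _ : S2, (1 : ℝ) ∂area = 4 * Real.pi := by
  rw [integral_const, smul_eq_mul, mul_one, area, Measure.toSphere_real_apply_univ,
    Measure.real, EuclideanSpace.volume_ball_fin_three, finrank_euclideanSpace_fin,
    ENNReal.toReal_mul, ENNReal.toReal_pow, ENNReal.toReal_ofReal zero_le_one,
    ENNReal.toReal_ofReal (by positivity)]
  push_cast
  ring

theorem SmoothFn.integral_grad {f : S2 → ℝ} (hf : SmoothFn f) (a : Fin 3) :
    ∫ x, grad f x a ∂area = 2 * ∫ x, coord a x * f x ∂area := by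
  obtain ⟨K, hK⟩ := exists_integral_grad_eq_mul
  have hsq (b : Fin 3) : SmoothFn (fun x => coord b x * coord b x) :=
    ContMDiff.mul (smoothFn_coord b) (smoothFn_coord b)
  have hint (b : Fin 3) : Integrable (fun x => coord b x * coord b x) area := (hsq b).integrable
  have hsum : ∑ b, ∫ x, coord b x * coord b x ∂area = 4 * Real.pi := by
    rw [← integral_finsetSum _ fun b _ => hint b, ← integral_one_area]
    simp only [S2.sum_coord_mul_coord]
  have hdiv : ∑ b, ∫ x, grad (coord b) x b ∂area = 2 * (4 * Real.pi) := by
    simp only [grad_coord, if_true, integral_sub (integrable_const _) (hint _),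
      Finset.sum_sub_distrib, hsum, integral_one_area]
    simp
    ring
  simp only [hK _ (smoothFn_coord _), ← Finset.mul_sum, hsum] at hdiv
  rw [hK f hf, mul_right_cancel₀ (by positivity) hdiv]

theorem SmoothFn.eq_zero_of_integral_mul_self {f : S2 → ℝ} (hf : SmoothFn f)
    (h : ∫ x, f x * f x ∂area = 0) (x : S2) : f x = 0 := by
  have hsq : SmoothFn (fun x => f x * f x) := ContMDiff.mul hf hf
  have hae := (integral_eq_zero_iff_of_nonneg (fun x => mul_self_nonneg (f x)) hsq.integrable).1 h
  have heq := (Continuous.ae_eq_iff_eq area hsq.continuous continuous_zero).1 hae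
  exact mul_self_eq_zero.1 (congrFun heq x)

/-- The algebra of smooth functions on the sphere. -/
abbrev SphereFun : Type := C^∞⟮𝓡 2, S2; 𝓘(ℝ, ℝ), ℝ⟯

namespace SphereFun

theorem smoothFn (f : SphereFun) : SmoothFn f := f.contMDiff

theorem sum_apply {ι : Type*} (s : Finset ι) (f : ι → SphereFun) (x : S2) :
    (∑ i ∈ s, f i) x = ∑ i ∈ s, f i x :=
  map_sum (ContMDiffMap.evalRingHom (I := 𝓡 2) (n := ∞) (R := ℝ) x) f s

theorem one_apply (x : S2) : (1 : SphereFun) x = 1 := rfl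

theorem add_apply (f g : SphereFun) (x : S2) : (f + g) x = f x + g x := rfl

theorem sub_apply (f g : SphereFun) (x : S2) : (f - g) x = f x - g x := rfl

theorem mul_apply (f g : SphereFun) (x : S2) : (f * g) x = f x * g x := rfl

theorem smul_apply (r : ℝ) (f : SphereFun) (x : S2) : (r • f) x = r * f x := rfl

theorem ofNat_apply (n : ℕ) [n.AtLeastTwo] (x : S2) :
    (ofNat(n) : SphereFun) x = ofNat(n) :=
  map_ofNat (ContMDiffMap.evalRingHom (I := 𝓡 2) (n := ∞) (R := ℝ) x) n

theorem ite_one_zero_apply (p : Prop) [Decidable p] (x : S2) :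
    (if p then 1 else 0 : SphereFun) x = if p then 1 else 0 := by
  split_ifs <;> rfl

/-- A Cartesian component of the gradient on the sphere, as a derivation. -/
def gradDerivation (a : Fin 3) : Derivation ℝ SphereFun SphereFun :=
  Derivation.mk'
    { toFun := fun f => ⟨fun x => grad f x a, f.smoothFn.grad a⟩
      map_add' := fun f g => by ext x; exact f.smoothFn.grad_add g.smoothFn x a
      map_smul' := fun r f => by ext x; exact f.smoothFn.grad_const_smul r x a }
    fun f g => by ext x; exact f.smoothFn.grad_mul g.smoothFn x a

/-- The integral over the sphere, as a linear map. -/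
def integral : SphereFun →ₗ[ℝ] ℝ where
  toFun f := ∫ x, f x ∂area
  map_add' f g := integral_add f.smoothFn.integrable g.smoothFn.integrable
  map_smul' r f := integral_const_mul r f

end SphereFun

/-- The tangential calculus of the round sphere `S²`. -/
def sphere : TangentialCalculus SphereFun where
  x a := ⟨coord a, smoothFn_coord a⟩
  D := SphereFun.gradDerivation
  int := SphereFun.integral
  sum_x_mul_x := by ext x; exact (SphereFun.sum_apply _ _ x).trans x.sum_coord_mul_coord
  D_x a b := by
    ext x
    rw [SphereFun.sub_apply, SphereFun.ite_one_zero_apply]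
    exact grad_coord b x a
  sum_x_mul_D f := by
    ext x
    exact (SphereFun.sum_apply _ _ x).trans (f.smoothFn.sum_coord_mul_grad x)
  D_comm a b f := by ext x; exact f.smoothFn.grad_grad_comm x a b
  int_D a f := f.smoothFn.integral_grad a
  int_one := integral_one_area
  int_mul_self_nonneg f := integral_nonneg fun x => mul_self_nonneg (f x)
  eq_zero_of_int_mul_self f h := by ext x; exact f.smoothFn.eq_zero_of_integral_mul_self h x
  eq_const_of_D_eq_zero f h := by
    obtain ⟨r, hr⟩ := f.smoothFn.exists_eq_const fun x a => DFunLike.congr_fun (h a) x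
    exact ⟨r, by ext x; exact hr x⟩

theorem sphere_x_apply (a : Fin 3) (x : S2) : sphere.x a x = coord a x := rfl

theorem sphere_D_apply (a : Fin 3) (f : SphereFun) (x : S2) : sphere.D a f x = grad f x a := rfl

theorem sphere_int (f : SphereFun) : sphere.int f = ∫ x, f x ∂area := rfl

theorem sphere_metric_apply (a b : Fin 3) (x : S2) : sphere.metric a b x = metric x a b := by
  rw [TangentialCalculus.metric, SphereFun.sub_apply, SphereFun.ite_one_zero_apply]
  rfl

theorem sphere_eps_apply (a b : Fin 3) (x : S2) : sphere.eps a b x = eps x a b := by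
  fin_cases a <;> fin_cases b <;> rfl

namespace TangentialCalculus

variable {A : Type*} [CommRing A] [Algebra ℝ A] {S : TangentialCalculus A}

theorem IsTangent.sum_metric_mul_D {w : Fin 3 → A} (hw : S.IsTangent w) (a b : Fin 3) :
    ∑ d, S.metric b d * S.D a (w d) = S.covDeriv₁ w a b := by
  have h := hw.sum_x_mul_D a
  simp only [metric, covDeriv₁_apply, sub_mul, ite_mul, one_mul, zero_mul, Finset.sum_sub_distrib,
    Finset.sum_ite_eq, Finset.mem_univ, if_true, mul_assoc, ← Finset.mul_sum, h]
  ring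

variable (S) in
theorem sum_metric_mul_metric_mul_D {T : Fin 3 → Fin 3 → A} (hT : ∀ a, S.IsTangent (T a))
    (htr : ∑ a, T a a = 0) (b : Fin 3) :
    ∑ a, ∑ d, ∑ e, S.metric a d * S.metric b e * S.D a (T d e) = S.div₂ T b := by
  have hcov (a d : Fin 3) : ∑ e, S.metric a d * S.metric b e * S.D a (T d e) =
      S.metric a d * S.D a (T d b) + S.x b * (S.metric d a * T d a) := by
    simp only [mul_assoc, ← Finset.mul_sum, (hT d).sum_metric_mul_D, covDeriv₁_apply,
      S.metric_comm d a]
    ring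
  have hgrad (d : Fin 3) : ∑ a, S.metric a d * S.D a (T d b) = S.D d (T d b) := by
    simpa only [S.metric_comm _ d, grad_apply] using (S.isTangent_grad (T d b)).sum_metric_mul d
  simp only [hcov]
  rw [Finset.sum_comm]
  simp only [Finset.sum_add_distrib, hgrad, ← Finset.mul_sum, (hT _).sum_metric_mul, htr, mul_zero,
    add_zero, div₂_apply]

theorem IsTangent.isTangent_curl {t : Fin 3 → A} (ht : S.IsTangent t) (b : Fin 3) :
    S.IsTangent (S.curl t b) := by
  simp only [IsTangent, S.curl_antisymm t _ b, mul_neg, Finset.sum_neg_distrib,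
    ht.sum_x_mul_curl b, neg_zero]

variable (S) in
theorem trace_curl (t : Fin 3 → A) : ∑ a, S.curl t a a = 0 := by simp [curl]

variable (S) in
theorem rotGrad_x (k a : Fin 3) : S.rotGrad (S.x k) a = S.rot k a := by
  have h := S.sum_metric_mul_eps k a
  simp only [rotGrad, rot, D_x_eq_metric, S.metric_comm _ k, S.eps_comm a, neg_mul,
    Finset.sum_neg_distrib, mul_comm (S.eps _ a), h]

end TangentialCalculus

/-! ### Tensor calculus on the sphere in terms of `sphere` -/

theorem covDeriv₁_eq {w : Fin 3 → SphereFun} (hw : sphere.IsTangent w) :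
    covDeriv₁ (fun x a => w a x) = fun x a b => sphere.covDeriv₁ w a b x := by
  ext x a b
  simp only [← hw.sum_metric_mul_D, SphereFun.sum_apply, SphereFun.mul_apply,
    sphere_metric_apply, sphere_D_apply, covDeriv₁]

theorem hess_eq (f : SphereFun) : hess f = fun x a b => sphere.hess f a b x :=
  covDeriv₁_eq (sphere.isTangent_grad f)

theorem lap_eq (f : SphereFun) : lap f = sphere.lap f := by
  ext x
  rw [← sphere.trace_hess, SphereFun.sum_apply]
  change ∑ a, hess f x a a = _
  rw [hess_eq]

theorem div₂_eq {T : Fin 3 → Fin 3 → SphereFun} (hT : ∀ a, sphere.IsTangent (T a))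
    (htr : ∑ a, T a a = 0) :
    div₂ (fun x a b => T a b x) = fun x b => sphere.div₂ T b x := by
  ext x b
  simp only [← sphere.sum_metric_mul_metric_mul_D hT htr, SphereFun.sum_apply,
    SphereFun.mul_apply, sphere_metric_apply, sphere_D_apply, div₂, covDeriv₂]

section

variable {C : Fin 3 → Fin 3 → SphereFun} (hC : sphere.IsSTT C)

include hC

theorem div₂_eq_of_isSTT : div₂ (fun x a b => C a b x) = fun x b => sphere.div₂ C b x :=
  NullInfinity.div₂_eq hC.isTangent_row hC.traceless

theorem curlDiv_eq :
    curlDiv (fun x a b => C a b x) = fun x b a => sphere.curl (sphere.div₂ C) b a x := by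
  ext x b a
  rw [curlDiv, div₂_eq_of_isSTT hC, covDeriv₁_eq hC.isTangent_div₂]
  rfl

theorem div₂_curlDiv_eq : div₂ (curlDiv fun x a b => C a b x) =
    fun x a => sphere.div₂ (sphere.curl (sphere.div₂ C)) a x := by
  rw [curlDiv_eq hC, NullInfinity.div₂_eq hC.isTangent_div₂.isTangent_curl (sphere.trace_curl _)]

end

theorem coclosedPart_eq (f : SphereFun) :
    coclosedPart f = fun x a b => ((1 / 2 : ℝ) • sphere.rotHess f) a b x := by
  ext x a b
  simp only [coclosedPart, hess_eq, Pi.smul_apply, SphereFun.smul_apply,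
    TangentialCalculus.rotHess_apply, SphereFun.sum_apply, SphereFun.add_apply,
    SphereFun.mul_apply, sphere_eps_apply]

theorem rot_eq (k : Fin 3) : rot k = fun x a => sphere.rot k a x := by
  ext x a
  simp only [← sphere.rotGrad_x, TangentialCalculus.rotGrad, SphereFun.sum_apply,
    SphereFun.mul_apply, sphere_eps_apply, sphere_D_apply, rot]
  rfl

theorem lowModes_eq (f : SphereFun) : lowModes f = sphere.lowModes f := by
  ext x
  simp only [lowModes, TangentialCalculus.lowModes_apply, SphereFun.add_apply,
    SphereFun.sum_apply, SphereFun.smul_apply, SphereFun.one_apply, mul_one, sphere_int,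
    SphereFun.mul_apply, sphere_x_apply]

theorem inner₂_eq (T T' : Fin 3 → Fin 3 → SphereFun) :
    inner₂ (fun x a b => T a b x) (fun x a b => T' a b x) =
      TangentialCalculus.inner₂ T T' := by
  ext x
  simp only [inner₂, TangentialCalculus.inner₂, SphereFun.sum_apply, SphereFun.mul_apply]

theorem hessTF_apply (f : SphereFun) (a b : Fin 3) (x : S2) :
    sphere.hessTF f a b x = 2 * hess f x a b - metric x a b * lap f x := by
  simp only [TangentialCalculus.hessTF_apply, two_mul, SphereFun.sub_apply, SphereFun.add_apply,
    SphereFun.mul_apply, sphere_metric_apply, hess_eq, lap_eq]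

theorem IsPotentials.toSphere {C : Fin 3 → Fin 3 → SphereFun} {c cb : SphereFun}
    (h : IsPotentials (fun x a b => C a b x) c cb) : sphere.IsPotentials C c cb where
  closed_mem := sphere.mem_highModes.2 h.high_c
  coclosed_mem := sphere.mem_highModes.2 h.high_cb
  two_smul_eq := by
    ext a b x
    have hx := h.decomposition x a b
    simp only [coclosedPart_eq, Pi.smul_apply, Pi.add_apply, SphereFun.smul_apply,
      SphereFun.add_apply, hessTF_apply] at hx ⊢
    linear_combination 2 * hx

/-- The fields `D` at retarded time `u` are the smooth fields `F` on the sphere. -/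
structure Fields.HasSlice (D : Fields) (u : ℝ) (F : Slice SphereFun) : Prop where
  m_eq : D.m u = F.m
  N_eq : D.N u = fun x a => F.N a x
  C_eq : D.C u = fun x a b => F.C a b x

namespace Fields.HasSlice

variable {D : Fields} {u : ℝ} {F : Slice SphereFun} (hF : D.HasSlice u F) (hC : sphere.IsSTT F.C)

include hF hC

theorem angularMomentum_eq (c : SphereFun) (k : Fin 3) :
    D.angularMomentum u c k = sphere.angularMomentum F c k := by
  rw [TangentialCalculus.angularMomentum, TangentialCalculus.pair_apply, sphere_int,
    Fields.angularMomentum, hF.m_eq, hF.N_eq, hF.C_eq, div₂_eq_of_isSTT hC, rot_eq]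
  refine integral_congr_ae (Filter.Eventually.of_forall fun x => ?_)
  simp only [TangentialCalculus.flux, TangentialCalculus.quad, TangentialCalculus.grad_apply,
    SphereFun.sum_apply, SphereFun.mul_apply, Pi.sub_apply, Pi.smul_apply, SphereFun.sub_apply,
    SphereFun.smul_apply, smul_eq_mul, sphere_D_apply]

theorem centerOfMass_eq (c cb : SphereFun) (k : Fin 3) :
    D.centerOfMass u c cb k = sphere.centerOfMass F u c cb k := by
  have hcb : div₂ (coclosedPart cb) =
      fun x b => ((1 / 2 : ℝ) • sphere.div₂ (sphere.rotHess cb)) b x := by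
    rw [coclosedPart_eq, div₂_eq_of_isSTT ((sphere.isSTT_rotHess cb).smul _), map_smul]
  rw [TangentialCalculus.centerOfMass, TangentialCalculus.pair_apply, sphere_int, sphere_int,
    Fields.centerOfMass, hF.m_eq, hF.N_eq, hF.C_eq, div₂_eq_of_isSTT hC, hcb, inner₂_eq]
  congr 1 <;> refine integral_congr_ae (Filter.Eventually.of_forall fun x => ?_)
  · simp only [TangentialCalculus.flux, TangentialCalculus.quad, TangentialCalculus.rotGrad,
      TangentialCalculus.grad_apply, SphereFun.sum_apply, SphereFun.mul_apply, Pi.add_apply,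
      Pi.sub_apply, Pi.smul_apply, SphereFun.add_apply, SphereFun.sub_apply, SphereFun.smul_apply,
      smul_eq_mul, sphere_D_apply, sphere_eps_apply]
    refine Finset.sum_congr rfl fun a _ => ?_
    change grad (coord k) x a * _ = grad (coord k) x a * _
    ring
  · simp only [SphereFun.mul_apply, Pi.smul_apply, SphereFun.sub_apply, SphereFun.smul_apply,
      SphereFun.add_apply, sphere_x_apply, Fin.sum_univ_three]
    ring

end Fields.HasSlice

/-! ### Stationary slices of null infinity -/

theorem SmoothOn.slice {I : Set ℝ} {F : ℝ → S2 → ℝ} (hF : SmoothOn I F) {u : ℝ} (hu : u ∈ I) :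
    SmoothFn (F u) := by
  have h : ContMDiff (𝓡 2) (𝓘(ℝ, ℝ).prod (𝓡 2)) ∞ (fun x : S2 => (u, x)) :=
    contMDiff_const.prodMk contMDiff_id
  rw [SmoothFn, ← contMDiffOn_univ]
  exact hF.comp h.contMDiffOn fun x _ => ⟨hu, Set.mem_univ _⟩

theorem SmoothOn.differentiableOn {I : Set ℝ} {F : ℝ → S2 → ℝ} (hF : SmoothOn I F) (x : S2) :
    DifferentiableOn ℝ (fun u => F u x) I := by
  have h : ContMDiff 𝓘(ℝ, ℝ) (𝓘(ℝ, ℝ).prod (𝓡 2)) ∞ (fun u : ℝ => (u, x)) :=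
    contMDiff_id.prodMk contMDiff_const
  have hFx := hF.comp h.contMDiffOn (s := I) fun u hu => ⟨hu, Set.mem_univ _⟩
  exact (contMDiffOn_iff_contDiffOn.1 hFx).differentiableOn (by simp)

theorem eq_add_mul_of_derivWithin_eq {I : Set ℝ} (hI : I.OrdConnected) {g : ℝ → ℝ}
    (hg : DifferentiableOn ℝ g I) {r : ℝ} (h : ∀ u ∈ I, derivWithin g I u = r) {u v : ℝ}
    (hu : u ∈ I) (hv : v ∈ I) : g v = g u + (v - u) * r := by
  have hd : ∀ w ∈ I, HasDerivWithinAt (fun w => g w - w * r) 0 I w := fun w hw => by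
    have hw' := (hg w hw).hasDerivWithinAt.sub ((hasDerivWithinAt_id w I).mul_const r)
    rwa [h w hw, one_mul, sub_self] at hw'
  have hconst := hI.convex.norm_image_sub_le_of_norm_hasDerivWithin_le (C := 0) hd (by simp) hu hv
  rw [zero_mul, norm_le_zero_iff] at hconst
  linear_combination hconst

theorem radialExt_zero : radialExt 0 = 0 := by
  ext y
  simp [radialExt]

theorem grad_zero : grad 0 = 0 := by
  ext x a
  simp [grad, radialExt_zero]

theorem covDeriv₁_zero : covDeriv₁ 0 = 0 := by
  ext x a b
  simp [covDeriv₁, grad_zero, ← Pi.zero_def]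

theorem div₁_zero : div₁ 0 = 0 := by
  ext x
  simp [div₁, covDeriv₁_zero]

theorem div₂_zero : div₂ 0 = 0 := by
  ext x b
  simp [div₂, covDeriv₂, grad_zero, ← Pi.zero_def]

theorem Fields.VanishingNews.news_eq_zero {D : Fields} {I : Set ℝ} (h : D.VanishingNews I)
    {u : ℝ} (hu : u ∈ I) : D.news I u = 0 := by
  ext x a b
  exact h u hu x a b

theorem Fields.supertranslate_zero (D : Fields) (I : Set ℝ) : D.supertranslate I 0 = D := by
  have hhess : hess 0 = 0 := by rw [hess, grad_zero, covDeriv₁_zero]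
  have hlap : lap 0 = 0 := by rw [lap, grad_zero, div₁_zero]
  simp [supertranslate, grad_zero, hhess, hlap, inner₂]

namespace Fields.IsNullInfinityData

variable {D : Fields} {I : Set ℝ} (hD : D.IsNullInfinityData I) {u v : ℝ} (hu : u ∈ I)

/-- The fields at retarded time `u`, as elements of the algebra of smooth functions. -/
def slice : Slice SphereFun where
  m := ⟨D.m u, hD.smooth_m.slice hu⟩
  N a := ⟨fun x => D.N u x a, (hD.smooth_N a).slice hu⟩
  C a b := ⟨fun x => D.C u x a b, (hD.smooth_C a b).slice hu⟩

theorem hasSlice : D.HasSlice u (hD.slice hu) := ⟨rfl, rfl, rfl⟩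

theorem isSTT_slice : sphere.IsSTT (hD.slice hu).C where
  symm a b := by
    ext x
    exact hD.symm_C u hu x a b
  tangent b := by
    ext x
    exact (SphereFun.sum_apply _ _ x).trans (hD.tangent_C u hu x b)
  traceless := by
    ext x
    exact (SphereFun.sum_apply _ _ x).trans (hD.traceless_C u hu x)

variable (hI : I.OrdConnected) (hnews : D.VanishingNews I) (hv : v ∈ I)

include hD hI hnews hu hv

theorem m_eq : D.m v = D.m u := by
  ext x
  have hder : ∀ w ∈ I, derivWithin (fun s => D.m s x) I w = 0 := fun w hw => by
    simp [hD.evolution_m w hw x, hnews.news_eq_zero hw, div₂_zero, div₁_zero, inner₂]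
  simpa only [mul_zero, add_zero] using
    eq_add_mul_of_derivWithin_eq hI (hD.smooth_m.differentiableOn x) hder hu hv

theorem C_eq : D.C v = D.C u := by
  ext x a b
  simpa only [mul_zero, add_zero] using eq_add_mul_of_derivWithin_eq hI
    ((hD.smooth_C a b).differentiableOn x) (fun w hw => hnews w hw x a b) hu hv

theorem N_eq (x : S2) (a : Fin 3) : D.N v x a = D.N u x a +
    (v - u) * (grad (D.m u) x a - (1 / 4) * div₂ (curlDiv (D.C u)) x a) := by
  refine eq_add_mul_of_derivWithin_eq hI ((hD.smooth_N a).differentiableOn x)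
    (fun w hw => ?_) hu hv
  have hinner (C : S2 → Fin 3 → Fin 3 → ℝ) : inner₂ C 0 = 0 := by
    ext y
    simp [inner₂]
  have hdiv : div₂ (fun _ _ _ => 0) = 0 := div₂_zero
  simp [hD.evolution_N w hw x a, hnews.news_eq_zero hw, hinner, hdiv, grad_zero, div₂_zero,
    hD.m_eq hu hI hnews hw, hD.C_eq hu hI hnews hw]

omit hv in
theorem hasSlice_supertranslate (f : SphereFun) {ub : ℝ} (hub : ∀ x, ub + f x ∈ I) :
    (D.supertranslate I f).HasSlice ub
      (sphere.supertranslate (hD.slice hu) ((ub - u) • 1 + f)) where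
  m_eq := by
    ext x
    have hder : ∀ b d, derivWithin (fun s => D.news I s x b d) I (ub + f x) = 0 := fun b d => by
      rw [derivWithin_congr (f := fun _ => (0 : ℝ)) (fun w hw => hnews w hw x b d)
        (hnews _ (hub x) x b d), derivWithin_fun_const, Pi.zero_apply]
    simp only [supertranslate, hnews.news_eq_zero (hub x), div₂_zero, hder,
      hD.m_eq hu hI hnews (hub x)]
    simp [inner₂]
    rfl
  N_eq := by
    ext x a
    have hτ (b : Fin 3) : sphere.D b ((ub - u) • 1 + f) = sphere.D b f := by
      rw [map_add, Derivation.map_smul, Derivation.map_one_eq_zero, smul_zero, zero_add]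
    simp only [Fields.supertranslate, hD.m_eq hu hI hnews (hub x), hD.C_eq hu hI hnews (hub x),
      hD.N_eq hu hI hnews (hub x)]
    rw [(hD.hasSlice hu).m_eq, (hD.hasSlice hu).N_eq, (hD.hasSlice hu).C_eq,
      div₂_curlDiv_eq (hD.isSTT_slice hu), curlDiv_eq (hD.isSTT_slice hu)]
    simp only [TangentialCalculus.supertranslate, TangentialCalculus.grad_apply, hτ, Pi.add_apply,
      Pi.sub_apply, Pi.smul_apply, smul_eq_mul, SphereFun.add_apply, SphereFun.sub_apply,
      SphereFun.smul_apply, SphereFun.mul_apply, SphereFun.sum_apply, SphereFun.ofNat_apply,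
      SphereFun.one_apply, sphere_D_apply]
    ring
  C_eq := by
    ext x a b
    simp only [Fields.supertranslate, TangentialCalculus.supertranslate, map_add, map_smul,
      sphere.hessTF_one, smul_zero, zero_add, Pi.sub_apply, SphereFun.sub_apply, hessTF_apply]
    rw [hD.C_eq hu hI hnews (hub x), (hD.hasSlice hu).C_eq]
    ring

end Fields.IsNullInfinityData

instance : CanLift (S2 → ℝ) SphereFun (⇑) SmoothFn := ⟨fun f hf => ⟨⟨f, hf⟩, rfl⟩⟩

theorem Fields.HasSlice.isPotentials {D : Fields} {u : ℝ} {F : Slice SphereFun}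
    (hF : D.HasSlice u F) {c cb : SphereFun} (h : IsPotentials (D.C u) c cb) :
    sphere.IsPotentials F.C c cb :=
  (hF.C_eq ▸ h).toSphere

theorem pair_rot_smul_grad (f g : SphereFun) (k : Fin 3) :
    sphere.pair (sphere.rot k) (f • sphere.grad g) =
      ∫ x, ∑ a, rot k x a * f x * grad g x a ∂area := by
  simp only [TangentialCalculus.pair_apply, sphere_int, rot_eq, SphereFun.sum_apply,
    Pi.smul_apply, smul_eq_mul, SphereFun.mul_apply, TangentialCalculus.grad_apply,
    sphere_D_apply, mul_assoc]

theorem six_int_sub_two_pair_grad_x_smul_grad (f g : SphereFun) (k : Fin 3) :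
    6 * sphere.int (f * sphere.x k * g) -
        2 * sphere.pair (sphere.grad (sphere.x k)) (f • sphere.grad g) =
      ∫ x, (6 * f x * coord k x * g x -
        2 * f x * ∑ a, grad (coord k) x a * grad g x a) ∂area := by
  rw [TangentialCalculus.pair_apply, ← smul_eq_mul, ← smul_eq_mul (2 : ℝ), ← map_smul, ← map_smul,
    ← map_sub, sphere_int]
  refine integral_congr_ae (Filter.Eventually.of_forall fun x => ?_)
  simp only [SphereFun.sub_apply, SphereFun.smul_apply, SphereFun.mul_apply, SphereFun.sum_apply,
    Pi.smul_apply, smul_eq_mul, TangentialCalculus.grad_apply, sphere_D_apply, sphere_x_apply,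
    mul_assoc, mul_left_comm _ (f x), ← Finset.mul_sum]
  rfl

namespace Fields.IsNullInfinityData

variable {D : Fields} {I : Set ℝ} (hD : D.IsNullInfinityData I) (hI : I.OrdConnected)
  (hnews : D.VanishingNews I) {u ub : ℝ} (hu : u ∈ I) {f : S2 → ℝ} (hf : SmoothFn f)
  (hub : ∀ x, ub + f x ∈ I) {c cb cbar cbbar : S2 → ℝ} (hc : IsPotentials (D.C u) c cb)
  (hcbar : IsPotentials ((D.supertranslate I f).C ub) cbar cbbar) (k : Fin 3)

include hD hI hnews hu hf hub hc hcbar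

theorem angularMomentum_supertranslate_sub :
    (D.supertranslate I f).angularMomentum ub cbar k - D.angularMomentum u c k =
      -2 * ∫ x, ∑ a, rot k x a * lowModes f x * grad (D.m u) x a ∂area := by
  lift f to SphereFun using hf
  lift c to SphereFun using hc.smooth_c
  lift cb to SphereFun using hc.smooth_cb
  lift cbar to SphereFun using hcbar.smooth_c
  lift cbbar to SphereFun using hcbar.smooth_cb
  have hF := hD.hasSlice hu
  have hC := hD.isSTT_slice hu
  have hF' := hD.hasSlice_supertranslate hu hI hnews f hub
  rw [hF.angularMomentum_eq hC, hF'.angularMomentum_eq (hC.sub (sphere.isSTT_hessTF _)),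
    (hF.isPotentials hc).angularMomentum_supertranslate_sub (hF'.isPotentials hcbar) hC k,
    pair_rot_smul_grad, lowModes_eq, hF.m_eq]

theorem centerOfMass_supertranslate_sub :
    (D.supertranslate I f).centerOfMass ub cbar cbbar k - D.centerOfMass u c cb k =
      ∫ x, (6 * lowModes f x * coord k x * D.m u x -
        2 * lowModes f x * ∑ a, grad (coord k) x a * grad (D.m u) x a) ∂area := by
  lift f to SphereFun using hf
  lift c to SphereFun using hc.smooth_c
  lift cb to SphereFun using hc.smooth_cb
  lift cbar to SphereFun using hcbar.smooth_c
  lift cbbar to SphereFun using hcbar.smooth_cb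
  have hF := hD.hasSlice hu
  have hC := hD.isSTT_slice hu
  have hF' := hD.hasSlice_supertranslate hu hI hnews f hub
  have h := (hF.isPotentials hc).centerOfMass_supertranslate_sub (hF'.isPotentials hcbar) hC u k
  rw [add_sub_cancel] at h
  rw [hF.centerOfMass_eq hC, hF'.centerOfMass_eq (hC.sub (sphere.isSTT_hessTF _)), h,
    six_int_sub_two_pair_grad_x_smul_grad, lowModes_eq, hF.m_eq]

end Fields.IsNullInfinityData

theorem lowModes_zero : lowModes 0 = 0 := by
  ext x
  simp [lowModes]

theorem smoothFn_zero : SmoothFn 0 := contMDiff_const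

namespace Fields.IsNullInfinityData

variable {D : Fields} {I : Set ℝ} (hD : D.IsNullInfinityData I) (hI : I.OrdConnected)
  (hnews : D.VanishingNews I) {u v : ℝ} (hu : u ∈ I) (hv : v ∈ I) {c cb c' cb' : S2 → ℝ}
  (hc : IsPotentials (D.C u) c cb) (hc' : IsPotentials (D.C v) c' cb') (k : Fin 3)

include hD hI hnews hu hv hc hc'

theorem angularMomentum_eq : D.angularMomentum v c' k = D.angularMomentum u c k := by
  have h := hD.angularMomentum_supertranslate_sub hI hnews hu smoothFn_zero (ub := v)
    (cbar := c') (cbbar := cb') (fun _ => by simpa) hc (by rwa [supertranslate_zero]) k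
  simpa [supertranslate_zero, lowModes_zero, sub_eq_zero] using h

theorem centerOfMass_eq : D.centerOfMass v c' cb' k = D.centerOfMass u c cb k := by
  have h := hD.centerOfMass_supertranslate_sub hI hnews hu smoothFn_zero (ub := v)
    (cbar := c') (cbbar := cb') (fun _ => by simpa) hc (by rwa [supertranslate_zero]) k
  simpa [supertranslate_zero, lowModes_zero, sub_eq_zero] using h

end Fields.IsNullInfinityData

end NullInfinity

end

theorem mainTheorem7 (I : Set ℝ) (hI : I.OrdConnected)
    (D : NullInfinity.Fields) (hD : D.IsNullInfinityData I) (hnews : D.VanishingNews I)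
    (c cb : ℝ → NullInfinity.S2 → ℝ)
    (hc : ∀ u ∈ I, NullInfinity.IsPotentials (D.C u) (c u) (cb u)) :
    (∀ k : Fin 3, ∀ u ∈ I, ∀ u' ∈ I,
      D.angularMomentum u (c u) k = D.angularMomentum u' (c u') k ∧
      D.centerOfMass u (c u) (cb u) k = D.centerOfMass u' (c u') (cb u') k) ∧
    ∀ f : NullInfinity.S2 → ℝ, NullInfinity.SmoothFn f →
      ∀ ub₀ : ℝ, (∀ x, ub₀ + f x ∈ I) →
      ∀ cbar cbbar : NullInfinity.S2 → ℝ,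
      NullInfinity.IsPotentials ((D.supertranslate I f).C ub₀) cbar cbbar →
      ∀ u₀ ∈ I, ∀ k : Fin 3,
        (D.supertranslate I f).angularMomentum ub₀ cbar k - D.angularMomentum u₀ (c u₀) k =
          -2 * ∫ x, ∑ a, NullInfinity.rot k x a * NullInfinity.lowModes f x *
            NullInfinity.grad (D.m u₀) x a ∂NullInfinity.area ∧
        (D.supertranslate I f).centerOfMass ub₀ cbar cbbar k
            - D.centerOfMass u₀ (c u₀) (cb u₀) k =
          ∫ x, (6 * NullInfinity.lowModes f x * NullInfinity.coord k x * D.m u₀ x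
            - 2 * NullInfinity.lowModes f x *
              ∑ a, NullInfinity.grad (NullInfinity.coord k) x a *
                NullInfinity.grad (D.m u₀) x a) ∂NullInfinity.area := by
  refine ⟨fun k u hu u' hu' => ⟨hD.angularMomentum_eq hI hnews hu' hu (hc u' hu') (hc u hu) k,
    hD.centerOfMass_eq hI hnews hu' hu (hc u' hu') (hc u hu) k⟩, ?_⟩
  intro f hf ub₀ hub cbar cbbar hbar u₀ hu₀ k
  exact ⟨hD.angularMomentum_supertranslate_sub hI hnews hu₀ hf hub (hc u₀ hu₀) hbar k,
    hD.centerOfMass_supertranslate_sub hI hnews hu₀ hf hub (hc u₀ hu₀) hbar k⟩
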